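/- Let $\mathcal X\subset\mathbb R^d$ be compact and convex with non-empty interior, and for $S\subseteq\mathcal X$ of positive volume let $\mathcal U(S)$ denote the uniform distribution on $S$. For $h:\mathcal X\to\mathbb R$ let $r_h(x,x')=\operatorname{sgn}(h(x)-h(x'))\in\{-1,0,1\}$ be its induced ranking rule, and let $\mathcal R_\infty=\{r_h: h:\mathcal X\to\mathbb R \text{ continuous}\}$. Let $\mathcal R_1\subset\mathcal R_2\subset\dots\subset\mathcal R_\infty$ be a nested sequence of sets of ranking rules, let $p\in(0,1)$, and let $f:\mathcal X\to\mathbb R$. For points $X_1,X_2,\dots$ of $\mathcal X$ put $$L_t(r)=\frac{2}{t(t-1)}\sum_{1\le i<j\le t}\mathbf 1\{r(X_i,X_j)\ne r_f(X_i,X_j)\}\quad(t\ge2),\qquad L_1\equiv 0,\qquad \hat k_t=\min\Big\{k\ge1:\min_{r\in\mathcal R_k}L_t(r)=0\Big\}.$$ The algorithm AdaRankOpt generates random points as follows: $X_1\sim\mathcal U(\mathcal X)$; for each $t\ge1$ a Bernoulli variable $B_{t+1}$ of parameter $p$, independent of $(X_i)_{1\le i\le t}$ and $(B_i)_{2\le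 i\le t}$, is drawn, and, conditionally on the past and on $B_{t+1}$, $X_{t+1}\sim\mathcal U(\mathcal X)$ if $B_{t+1}=1$, while if $B_{t+1}=0$ $$X_{t+1}\sim\mathcal U\big(\{x\in\mathcal X:\exists r\in\mathcal R_{\hat k_t},\ L_t(r)=0,\ r(x,X_{\hat\imath_t})\ge0\}\big),\qquad \hat\imath_t\in\arg\max_{1\le i\le t}f(X_i).$$ Let $L(r)=\mathbb P(r(X,X')\ne r_f(X,X'))$ for $X,X'$ independent with law $\mathcal U(\mathcal X)$. For a set $\mathcal R$ of ranking rules and $n\ge 1$ let $$R_n(\mathcal R)=\sup_{r\in\mathcal R}\frac1{\lfloor n/2\rfloor}\Big|\sum_{i=1}^{\lfloor n/2\rfloor}\epsilon_i\,\mathbf 1\{r(X'_i,X'_{\lfloor n/2\rfloor+i})\ne r_f(X'_i,X'_{\lfloor n/2\rfloor+i})\}\Big|\qquad(R_1(\mathcal R)=0),$$ where $X'_1,\dots,X'_n$ are i.i.d. with law $\mathcal U(\mathcal X)$ and $\epsilon_1,\dots,\epsilon_{\lfloor n/2\rfloor}$ are i.i.d. Rademacher signs independent of them. Put $k^\star=\min\{k\ge1:r_f\in\mathcal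 R_k\}$ and $\tau_{k^\star}=\min\{t\ge1:\hat k_t=k^\star\}$. **Proposition (Stopping Time Upper Bound).** Assume that $k^\star$ is finite and $k^\star>1$, that $\mathcal R_{k^\star-1}$ is non-empty with $\inf_{r\in\mathcal R_{k^\star-1}}L(r)>0$, and that there is a constant $K>0$ such that for all $n\ge1$ the variable $R_n(\mathcal R_{k^\star-1})$ is integrable with $\mathbb E[R_n(\mathcal R_{k^\star-1})]\le\sqrt{K/n}$. Then for every $\delta\in(0,1)$, with probability at least $1-\delta$, $$\tau_{k^\star}\le\frac{10}{p}\cdot\frac{K+\ln(2/\delta)}{\big(\inf_{r\in\mathcal R_{k^\star-1}}L(r)\big)^2}.$$ -/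

import Mathlib

open MeasureTheory ProbabilityTheory
open scoped ENNReal

namespace AdaRank

noncomputable section

/-- A ranking rule over a domain `𝒳 ⊆ ℝᵈ`: a map `𝒳 × 𝒳 → {-1, 0, 1}`. -/
abbrev RankingRule {d : ℕ} (𝒳 : Set (EuclideanSpace ℝ (Fin d))) : Type :=
  𝒳 → 𝒳 → SignType

variable {d : ℕ} {𝒳 : Set (EuclideanSpace ℝ (Fin d))}

/-- The ranking rule `r_f (x, x') = sgn (f x - f x')` induced by `f : 𝒳 → ℝ`. -/
def inducedRule (f : 𝒳 → ℝ) : RankingRule 𝒳 :=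
  fun x x' => SignType.sign (f x - f x')

/-- The set `R_∞` of continuous ranking rules. -/
def continuousRules (𝒳 : Set (EuclideanSpace ℝ (Fin d))) : Set (RankingRule 𝒳) :=
  {r | ∃ h : 𝒳 → ℝ, Continuous h ∧ r = inducedRule h}

/-- The uniform distribution `U(S)` over `S ⊆ 𝒳`: normalized Lebesgue measure on `S`.
(It is the zero measure, hence not a probability distribution, when `S` is Lebesgue-null.) -/
def unif (S : Set 𝒳) : Measure 𝒳 := ProbabilityTheory.cond (Measure.comap Subtype.val volume) S

/-- The empirical ranking loss `L_t(r)` over the sample `x 1, …, x t`.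
For `t = 1` there is no pair to compare and the value is `0`. -/
def empLoss (f : 𝒳 → ℝ) (x : ℕ → 𝒳) (t : ℕ) (r : RankingRule 𝒳) : ℝ :=
  2 / ((t : ℝ) * ((t : ℝ) - 1)) *
    ∑ j ∈ Finset.Icc 1 t, ∑ i ∈ Finset.Ico 1 j,
      if r (x i) (x j) ≠ inducedRule f (x i) (x j) then 1 else 0

/-- The true ranking loss `L(r) = ℙ(r(X, X') ≠ r_f(X, X'))`, for `X, X'` i.i.d. uniform. -/
def trueLoss (f : 𝒳 → ℝ) (r : RankingRule 𝒳) : ℝ :=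
  ((unif (Set.univ : Set 𝒳)).prod (unif Set.univ)).real
    {z | r z.1 z.2 ≠ inducedRule f z.1 z.2}

/-- Model selection: `k̂_t = min {k ≥ 1 : min_{r ∈ R_k} L_t(r) = 0}` for the sample
`x 1, …, x t`. -/
def kHat (f : 𝒳 → ℝ) (R : ℕ → Set (RankingRule 𝒳)) (x : ℕ → 𝒳) (t : ℕ) : ℕ :=
  sInf {k | 1 ≤ k ∧ ∃ r ∈ R k, empLoss f x t r = 0}

/-- The set from which the next point is drawn in an exploitation step, after the sample
`x 1, …, x t` and for the incumbent `best`. -/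
def exploitRegion (f : 𝒳 → ℝ) (R : ℕ → Set (RankingRule 𝒳)) (x : ℕ → 𝒳) (t : ℕ)
    (best : 𝒳) : Set 𝒳 :=
  {y | ∃ r ∈ R (kHat f R x t), empLoss f x t r = 0 ∧ 0 ≤ r y best}

section Run

variable {Ω : Type*}

/-- The `σ`-algebra generated by `X_1, …, X_t` and `B_2, …, B_t`. -/
@[reducible] def history (X : ℕ → Ω → 𝒳) (B : ℕ → Ω → Bool) (t : ℕ) : MeasurableSpace Ω :=
  (⨆ i ∈ Finset.Icc 1 t, MeasurableSpace.comap (X i) inferInstance) ⊔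
    ⨆ i ∈ Finset.Icc 2 t, MeasurableSpace.comap (B i) inferInstance

/-- `X_1, X_2, …` are the evaluation points, `B_2, B_3, …` the exploration coins (`true` meaning
exploration) and `best t` the index of an incumbent after `t` evaluations (ties broken
arbitrarily) of a run of AdaRankOpt. The entries `X 0`, `B 0`, `B 1` and `best 0` play no role.

The field `step` says that the conditional distribution of `X_{t+1}` given the history and
`B_{t+1}` is `U(𝒳)` if `B_{t+1} = 1` and `U(exploitRegion)` if `B_{t+1} = 0`. -/
structure IsAdaRankOpt [MeasurableSpace Ω] (P : Measure Ω) (f : 𝒳 → ℝ) (p : ℝ)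
    (R : ℕ → Set (RankingRule 𝒳))
    (X : ℕ → Ω → 𝒳) (B : ℕ → Ω → Bool) (best : ℕ → Ω → ℕ) : Prop where
  measurable_X : ∀ t, 1 ≤ t → Measurable (X t)
  measurable_B : ∀ t, 2 ≤ t → Measurable (B t)
  best_mem : ∀ t, 1 ≤ t → ∀ ω, best t ω ∈ Finset.Icc 1 t
  best_max : ∀ t, 1 ≤ t → ∀ ω, ∀ i ∈ Finset.Icc 1 t, f (X i ω) ≤ f (X (best t ω) ω)
  init : P.map (X 1) = unif Set.univ
  bernoulli : ∀ t, 1 ≤ t → P {ω | B (t + 1) ω = true} = ENNReal.ofReal p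
  indep : ∀ t, 1 ≤ t →
    Indep (MeasurableSpace.comap (B (t + 1)) inferInstance) (history X B t) P
  step : ∀ t, 1 ≤ t → ∀ A : Set 𝒳, MeasurableSet A →
    P[(X (t + 1) ⁻¹' A).indicator (fun _ => (1 : ℝ)) |
        history X B t ⊔ MeasurableSpace.comap (B (t + 1)) inferInstance]
      =ᵐ[P] fun ω =>
        if B (t + 1) ω = true then (unif (Set.univ : Set 𝒳)).real A
        else (unif (exploitRegion f R (fun i => X i ω) t (X (best t ω) ω))).real A

/-- The stopping time `τ_k = min {t ≥ 1 : k̂_t = k}`, equal to `∞` if there is no such `t`. -/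
def stoppingTime (f : 𝒳 → ℝ) (R : ℕ → Set (RankingRule 𝒳)) (X : ℕ → Ω → 𝒳) (k : ℕ)
    (ω : Ω) : ℕ∞ :=
  ⨅ (t : ℕ) (_ : 1 ≤ t ∧ kHat f R (fun i => X i ω) t = k), (t : ℕ∞)

end Run

/-- The law of a Rademacher variable. -/
def rademacher : Measure ℝ :=
  (2 : ℝ≥0∞)⁻¹ • Measure.dirac 1 + (2 : ℝ≥0∞)⁻¹ • Measure.dirac (-1)

/-- The random variable `R_n(𝓡)` as a function of the points `x = (X_1, …, X_n)`
and of the signs `ε`. -/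
def rademacherAvg (f : 𝒳 → ℝ) (𝓡 : Set (RankingRule 𝒳)) (n : ℕ)
    (z : (Fin n → 𝒳) × (Fin (n / 2) → ℝ)) : ℝ :=
  ⨆ r : 𝓡, ((n / 2 : ℕ) : ℝ)⁻¹ *
    |∑ i : Fin (n / 2), z.2 i *
      if r.1 (z.1 ⟨i, by omega⟩) (z.1 ⟨n / 2 + i, by omega⟩) ≠
        inducedRule f (z.1 ⟨i, by omega⟩) (z.1 ⟨n / 2 + i, by omega⟩) then 1 else 0|

/-- The joint law of `n` i.i.d. uniform points of `𝒳` and, independently of them, of `⌊n/2⌋`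
i.i.d. Rademacher signs. -/
def rademacherLaw (𝒳 : Set (EuclideanSpace ℝ (Fin d))) (n : ℕ) :
    Measure ((Fin n → 𝒳) × (Fin (n / 2) → ℝ)) :=
  (Measure.pi fun _ => unif Set.univ).prod (Measure.pi fun _ => rademacher)

end

end AdaRank

open AdaRank

/-!
Until the selected index reaches `k⋆`, some rule of `R (k⋆ - 1)` is consistent with the whole
sample, hence with `r_f` on every pair of exploration points. It suffices to bound the probability
of this event at the fixed time `t = ⌊10 q / p⌋`, where `q = (K + l) / L²`, `l = log (2 / δ)` and
`L` is the infimum of the true losses. This follows from two facts, each of which fails with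
probability at most `δ / 2`.

* At least `n = 2 ⌈5 q / 2⌉` of the points up to time `t` come from exploration. A Hoeffding bound
  for the number of exploration coins would need `t` of order `1 / p²`; instead its Laplace
  transform at `log 2`, which is `(1 - p / 2) ^ (t - 1)`, is used
  (`IsAdaRankOpt.measure_coinCount_le`). The rounding in `t` and `n` is absorbed by `K ≥ 2 L²`, a
  consequence of the hypothesis for two points (`two_mul_sq_le_of_rademacherAvg`).
* No rule of `R (k⋆ - 1)` is consistent with `n` i.i.d. uniform points
  (`measure_exists_consistent_le`). The losses on the `n / 2` disjoint pairs are i.i.d., and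
  symmetrization with a ghost sample together with McDiarmid's inequality bounds the probability by
  `exp (-n (L - 2 √(K / n))²)`, which is at most `exp (-l)` since `(2 √K + √l)² ≤ 5 (K + l)`.

They are combined by conditioning on the coins: given their values, the points of the exploration
steps are i.i.d. uniform (`IsAdaRankOpt.measure_coinEvent_inter`), whatever the exploitation steps
do.

The class of rules is arbitrary, so suprema over it need not be measurable; only the Rademacher
averages are assumed to be so, almost everywhere. For this reason the deviation
`sup_r (L r - L_m r)` never appears: it is replaced by the conditional expectation, given
the sample, of the average `symmetrized` of Rademacher suprema over all sign patterns. It dominates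
the deviation almost surely, has expectation twice the Rademacher average and has
bounded differences `1 / m` on a conull set.
-/

namespace AdaRank

/-! ### Product measures -/

/-- Distinct coordinates of an i.i.d. family form an i.i.d. family. -/
theorem measurePreserving_comp_injective {ι κ Y : Type*} [Fintype ι] [Fintype κ]
    [MeasurableSpace Y] (ν : Measure Y) [IsProbabilityMeasure ν] {e : κ → ι}
    (he : Function.Injective e) :
    MeasurePreserving (fun (x : ι → Y) (k : κ) => x (e k))
      (Measure.pi fun _ => ν) (Measure.pi fun _ => ν) := by
  classical
  have hmeas : Measurable (fun (x : ι → Y) (k : κ) => x (e k)) := by fun_prop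
  refine ⟨hmeas, (Measure.pi_eq fun s hs => ?_).symm⟩
  rw [Measure.map_apply hmeas (MeasurableSet.univ_pi hs)]
  have hset : (fun (x : ι → Y) (k : κ) => x (e k)) ⁻¹' (Set.univ.pi s) =
      Set.univ.pi (fun i => ⋂ (k : κ) (_ : e k = i), s k) := by
    ext x
    simp only [Set.mem_preimage, Set.mem_pi, Set.mem_univ, forall_const, Set.mem_iInter]
    exact ⟨fun h i k hk => hk ▸ h k, fun h k => h _ k rfl⟩
  rw [hset, Measure.pi_pi]
  have hval : ∀ k, ν (⋂ (k' : κ) (_ : e k' = e k), s k') = ν (s k) := by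
    intro k
    congr 1
    ext y
    simp only [Set.mem_iInter]
    exact ⟨fun h => h k rfl, fun h k' hk' => he hk' ▸ h⟩
  rw [← Finset.prod_subset (Finset.subset_univ (Finset.univ.image e)), Finset.prod_image he.injOn]
  · exact Finset.prod_congr rfl fun k _ => hval k
  · intro i _ hi
    have : (⋂ (k : κ) (_ : e k = i), s k) = Set.univ := by
      refine Set.eq_univ_of_forall fun y => ?_
      simp only [Set.mem_iInter]
      rintro k rfl
      exact absurd (Finset.mem_image_of_mem e (Finset.mem_univ k)) hi
    rw [this, measure_univ]

/-- The sample which takes its `k`-th point from `z.2` if `σ k` holds, and from `z.1` otherwise. -/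
def select {κ Y : Type*} (σ : κ → Bool) (z : (κ → Y) × (κ → Y)) (k : κ) : Y :=
  if σ k then z.2 k else z.1 k

/-- Choosing each coordinate from either of two independent i.i.d. samples gives an i.i.d.
sample. -/
theorem measurePreserving_select {κ Y : Type*} [Fintype κ] [MeasurableSpace Y] (ν : Measure Y)
    [IsProbabilityMeasure ν] (σ : κ → Bool) :
    MeasurePreserving (select σ)
      ((Measure.pi fun _ => ν).prod (Measure.pi fun _ => ν)) (Measure.pi fun _ => ν) := by
  have he : Function.Injective (fun k : κ => if σ k then Sum.inr k else (Sum.inl k : κ ⊕ κ)) := by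
    intro a b hab
    by_cases ha : σ a <;> by_cases hb : σ b <;> simp_all
  convert (measurePreserving_comp_injective ν he).comp
    (measurePreserving_sumPiEquivProdPi_symm (X := fun _ : κ ⊕ κ => Y) fun _ => ν) using 1
  ext z k
  by_cases h : σ k <;> simp [select, h, MeasurableEquiv.sumPiEquivProdPi, Equiv.sumPiEquivProdPi]

/-! ### McDiarmid's inequality -/

/-- **Hoeffding's lemma** for a function whose values on a conull set differ by at most `c`. -/
theorem integral_exp_le_of_abs_sub_le {Y : Type*} [MeasurableSpace Y] (ν : Measure Y)
    [IsProbabilityMeasure ν] {c : ℝ} (s : ℝ) {g : Y → ℝ}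
    (hg : AEStronglyMeasurable g ν) {S : Set Y} (hS : ∀ᵐ y ∂ν, y ∈ S)
    (hdiff : ∀ x ∈ S, ∀ y ∈ S, |g x - g y| ≤ c) :
    ∫ y, Real.exp (s * g y) ∂ν ≤ Real.exp (s * ∫ y, g y ∂ν + s ^ 2 * c ^ 2 / 8) := by
  obtain ⟨x₀, hx₀⟩ : S.Nonempty := by
    obtain ⟨y, hy⟩ := hS.exists
    exact ⟨y, hy⟩
  have hbdd : BddBelow (g '' S) := by
    refine ⟨g x₀ - c, ?_⟩
    rintro _ ⟨y, hy, rfl⟩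
    linarith [(abs_le.1 (hdiff x₀ hx₀ y hy)).2]
  set a := sInf (g '' S) with ha
  have hIcc : ∀ᵐ y ∂ν, g y ∈ Set.Icc a (a + c) := by
    filter_upwards [hS] with y hy
    refine ⟨csInf_le hbdd ⟨y, hy, rfl⟩, ?_⟩
    have : g y - c ≤ a := by
      refine le_csInf ⟨_, x₀, hx₀, rfl⟩ ?_
      rintro _ ⟨z, hz, rfl⟩
      linarith [(abs_le.1 (hdiff y hy z hz)).2]
    linarith
  have h := (hasSubgaussianMGF_of_mem_Icc hg.aemeasurable hIcc).mgf_le s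
  have heq : mgf (fun y => g y - ∫ x, g x ∂ν) ν s =
      Real.exp (-(s * ∫ y, g y ∂ν)) * ∫ y, Real.exp (s * g y) ∂ν := by
    rw [mgf, ← integral_const_mul]
    refine integral_congr_ae (.of_forall fun y => ?_)
    simp only [← Real.exp_add]
    congr 1
    ring
  rw [heq, Real.exp_neg, inv_mul_le_iff₀ (Real.exp_pos _), ← Real.exp_add] at h
  refine h.trans (Real.exp_le_exp.2 (le_of_eq ?_))
  simp [div_pow]
  ring

/-- The exponential moment bound behind **McDiarmid's inequality**, on a finite power of a
probability space. The bounded differences are only required on a conull set `T`, so that it applies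
to a function which is defined by an integral over another variable. -/
theorem integral_exp_le_of_boundedDifferences {Y : Type*} [MeasurableSpace Y] (ν : Measure Y)
    [IsProbabilityMeasure ν] {c : ℝ} (s : ℝ) : ∀ (m : ℕ) (h : (Fin m → Y) → ℝ)
    (_ : AEStronglyMeasurable h (Measure.pi fun _ => ν)) {C : ℝ} (_ : ∀ x, |h x| ≤ C)
    {T : Set (Fin m → Y)} (_ : ∀ᵐ x ∂(Measure.pi fun _ => ν), x ∈ T)
    (_ : ∀ x ∈ T, ∀ j y, Function.update x j y ∈ T → |h x - h (Function.update x j y)| ≤ c),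
    ∫ x, Real.exp (s * h x) ∂(Measure.pi fun _ => ν) ≤
      Real.exp (s * ∫ x, h x ∂(Measure.pi fun _ => ν) + m * (s ^ 2 * c ^ 2 / 8)) := by
  intro m
  induction m with
  | zero =>
    intro h _ C _ T _ _
    have hc : ∀ x, h x = h fun i => i.elim0 := fun x => congrArg h (Subsingleton.elim _ _)
    simp [hc]
  | succ m ih =>
    intro h hmeas C hC T hT hdiff
    have hmp := (measurePreserving_piFinSuccAbove (fun _ : Fin (m + 1) => ν) 0).symm
    set e := (MeasurableEquiv.piFinSuccAbove (fun _ : Fin (m + 1) => Y) 0).symm with he_def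
    have he : ∀ a x, e (a, x) = Fin.cons a x := fun a x => by
      simp [he_def, MeasurableEquiv.piFinSuccAbove, Fin.insertNthEquiv]
    set π : Measure (Fin m → Y) := Measure.pi fun _ => ν with hπ
    have hmeas' : AEStronglyMeasurable (fun z => h (e z)) (ν.prod π) :=
      hmeas.comp_measurePreserving hmp
    have hint : Integrable (fun z => h (e z)) (ν.prod π) :=
      Integrable.of_bound hmeas' C (.of_forall fun z => hC _)
    have hintexp : Integrable (fun z => Real.exp (s * h (e z))) (ν.prod π) := by
      refine Integrable.of_bound (Real.continuous_exp.comp_aestronglyMeasurable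
        (hmeas'.const_mul s)) (Real.exp (|s| * C)) (.of_forall fun z => ?_)
      rw [Real.norm_eq_abs, Real.abs_exp, Real.exp_le_exp]
      calc s * h (e z) ≤ |s * h (e z)| := le_abs_self _
        _ = |s| * |h (e z)| := abs_mul _ _
        _ ≤ |s| * C := by gcongr; exact hC _
    have hT' : ∀ᵐ a ∂ν, ∀ᵐ x ∂π, e (a, x) ∈ T :=
      Measure.ae_ae_of_ae_prod (hmp.quasiMeasurePreserving.ae hT)
    set g : Y → ℝ := fun a => ∫ x, h (e (a, x)) ∂π with hg
    have hsec : ∀ᵐ a ∂ν, Integrable (fun x => h (e (a, x))) π := hint.prod_right_ae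
    rw [← hmp.integral_comp', ← hmp.integral_comp', integral_prod _ hint, integral_prod _ hintexp]
    -- the inner integral, by induction
    have hinner : ∀ᵐ a ∂ν, ∫ x, Real.exp (s * h (e (a, x))) ∂π ≤
        Real.exp (m * (s ^ 2 * c ^ 2 / 8)) * Real.exp (s * g a) := by
      filter_upwards [hT', hsec] with a ha hsa
      rw [← Real.exp_add, add_comm ((m : ℝ) * _)]
      refine ih (fun x => h (e (a, x))) hsa.aestronglyMeasurable (fun x => hC _)
        (T := {x | e (a, x) ∈ T}) ha ?_
      intro x hx j y hy
      simp only [Set.mem_ofPred_eq, he] at hx hy ⊢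
      rw [Fin.cons_update] at hy ⊢
      exact hdiff _ hx _ _ hy
    -- the outer integral, by Hoeffding's lemma
    have houter := integral_exp_le_of_abs_sub_le ν (c := c) s (g := g)
      hint.integral_prod_left.aestronglyMeasurable (hT'.and hsec) (by
        rintro a ⟨ha, hsa⟩ b ⟨hb, hsb⟩
        simp only [hg]
        rw [← integral_sub hsa hsb]
        suffices hle : ∀ᵐ x ∂π, ‖h (e (a, x)) - h (e (b, x))‖ ≤ c by
          have := norm_integral_le_of_norm_le_const hle
          rwa [probReal_univ, mul_one] at this
        filter_upwards [ha, hb] with x hax hbx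
        rw [he] at hax hbx ⊢
        rw [he]
        have := hdiff _ hax 0 b (by rwa [Fin.update_cons_zero])
        rwa [Fin.update_cons_zero] at this)
    have hgexp : Integrable (fun a => Real.exp (s * g a)) ν := by
      refine Integrable.of_bound (Real.continuous_exp.comp_aestronglyMeasurable
        (hint.integral_prod_left.aestronglyMeasurable.const_mul s)) (Real.exp (|s| * C))
        (.of_forall fun z => ?_)
      rw [Real.norm_eq_abs, Real.abs_exp, Real.exp_le_exp]
      calc s * g z ≤ |s * g z| := le_abs_self _
        _ = |s| * |g z| := abs_mul _ _
        _ ≤ |s| * C := by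
          gcongr
          have := norm_integral_le_of_norm_le_const (μ := π) (f := fun x => h (e (z, x)))
            (.of_forall fun x => hC _)
          rwa [probReal_univ, mul_one] at this
    calc ∫ a, ∫ x, Real.exp (s * h (e (a, x))) ∂π ∂ν
        ≤ ∫ a, Real.exp (m * (s ^ 2 * c ^ 2 / 8)) * Real.exp (s * g a) ∂ν :=
          integral_mono_ae hintexp.integral_prod_left (hgexp.const_mul _) hinner
      _ ≤ Real.exp (m * (s ^ 2 * c ^ 2 / 8)) *
          Real.exp (s * ∫ y, g y ∂ν + s ^ 2 * c ^ 2 / 8) := by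
          rw [integral_const_mul]
          gcongr
      _ = _ := by
          rw [← Real.exp_add]
          congr 1
          push_cast
          ring

/-! ### Symmetrization and uniform deviations -/

/-- The sign `±1` encoded by a Boolean. -/
def boolSign (b : Bool) : ℝ := if b then 1 else -1

theorem abs_boolSign (b : Bool) : |boolSign b| = 1 := by cases b <;> simp [boolSign]

section Symmetrization

variable {ι Y : Type*} {m : ℕ}

/-- The normalized supremum `sup_i |∑ j, ε j * ℓ i (y j)| / m` for a family of losses `ℓ i`, at the
sample `y` and the signs `ε`. -/
noncomputable def signedSup (ℓ : ι → Y → ℝ) (ε : Fin m → ℝ) (y : Fin m → Y) : ℝ :=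
  ⨆ i, (m : ℝ)⁻¹ * |∑ j, ε j * ℓ i (y j)|

/-- The average over all sign patterns `σ` of the signed suprema at the two samples obtained from
`z.1` and `z.2` by exchanging their points according to `σ`. -/
noncomputable def symmetrized (ℓ : ι → Y → ℝ) (z : (Fin m → Y) × (Fin m → Y)) : ℝ :=
  ((2 : ℝ) ^ m)⁻¹ * ∑ σ : Fin m → Bool, (signedSup ℓ (boolSign ∘ σ) (select σ z) +
    signedSup ℓ (boolSign ∘ σ) (select (fun k => !σ k) z))

theorem select_update_of_true {κ : Type*} [DecidableEq κ] {σ : κ → Bool} {j : κ} (h : σ j = true)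
    (x x' : κ → Y) (a : Y) : select σ (Function.update x j a, x') = select σ (x, x') := by
  ext k
  by_cases hk : k = j
  · subst hk; simp [select, h]
  · simp [select, hk]

theorem select_update_of_false {κ : Type*} [DecidableEq κ] {σ : κ → Bool} {j : κ}
    (h : σ j = false) (x x' : κ → Y) (a : Y) :
    select σ (Function.update x j a, x') = Function.update (select σ (x, x')) j a := by
  ext k
  by_cases hk : k = j
  · subst hk; simp [select, h]
  · simp [select, hk]

section Bounds

variable {ℓ : ι → Y → ℝ}

theorem signedSup_term_le_one
    (hℓ : ∀ i y, ℓ i y ∈ Set.Icc (0 : ℝ) 1) {ε : Fin m → ℝ} (hε : ∀ j, |ε j| ≤ 1)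
    (y : Fin m → Y) (i : ι) :
    (m : ℝ)⁻¹ * |∑ j, ε j * ℓ i (y j)| ≤ 1 := by
  have h : |∑ j, ε j * ℓ i (y j)| ≤ m := by
    refine (Finset.abs_sum_le_sum_abs _ _).trans ?_
    refine (Finset.sum_le_card_nsmul _ _ 1 fun j _ => ?_).trans (by simp)
    rw [abs_mul, abs_of_nonneg (hℓ i _).1]
    exact mul_le_one₀ (hε j) (hℓ i _).1 (hℓ i _).2
  exact (mul_le_mul_of_nonneg_left h (by positivity)).trans inv_mul_le_one

theorem bddAbove_signedSup
    (hℓ : ∀ i y, ℓ i y ∈ Set.Icc (0 : ℝ) 1) {ε : Fin m → ℝ} (hε : ∀ j, |ε j| ≤ 1) (y : Fin m → Y) :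
    BddAbove (Set.range fun i => (m : ℝ)⁻¹ * |∑ j, ε j * ℓ i (y j)|) :=
  ⟨1, by rintro _ ⟨i, rfl⟩; exact signedSup_term_le_one hℓ hε y i⟩

theorem signedSup_mem_Icc
    (hℓ : ∀ i y, ℓ i y ∈ Set.Icc (0 : ℝ) 1) {ε : Fin m → ℝ} (hε : ∀ j, |ε j| ≤ 1) (y : Fin m → Y) :
    signedSup ℓ ε y ∈ Set.Icc (0 : ℝ) 1 :=
  ⟨Real.iSup_nonneg fun _ => by positivity,
    Real.iSup_le (fun i => signedSup_term_le_one hℓ hε y i) zero_le_one⟩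

theorem signedSup_le_signedSup_add [Nonempty ι]
    (hℓ : ∀ i y, ℓ i y ∈ Set.Icc (0 : ℝ) 1) {ε : Fin m → ℝ} (hε : ∀ j, |ε j| ≤ 1)
    {x y : Fin m → Y} (j : Fin m) (hxy : ∀ k ≠ j, x k = y k) :
    signedSup ℓ ε x ≤ signedSup ℓ ε y + (m : ℝ)⁻¹ := by
  refine ciSup_le fun i => ?_
  have h1 : (m : ℝ)⁻¹ * |∑ k, ε k * ℓ i (y k)| ≤ signedSup ℓ ε y :=
    le_ciSup (bddAbove_signedSup hℓ hε y) i
  have h2 : ∑ k, ε k * ℓ i (x k) = ∑ k, ε k * ℓ i (y k) + ε j * (ℓ i (x j) - ℓ i (y j)) := by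
    rw [← sub_eq_iff_eq_add', ← Finset.sum_sub_distrib, Finset.sum_eq_single j]
    · ring
    · intro k _ hk
      rw [hxy k hk, sub_self]
    · simp
  have h3 : |ε j * (ℓ i (x j) - ℓ i (y j))| ≤ 1 := by
    rw [abs_mul]
    refine mul_le_one₀ (hε j) (abs_nonneg _) (abs_le.2 ⟨?_, ?_⟩)
    · linarith [(hℓ i (x j)).1, (hℓ i (y j)).2]
    · linarith [(hℓ i (x j)).2, (hℓ i (y j)).1]
  calc (m : ℝ)⁻¹ * |∑ k, ε k * ℓ i (x k)|
      ≤ (m : ℝ)⁻¹ * (|∑ k, ε k * ℓ i (y k)| + 1) := by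
        rw [h2]
        gcongr
        exact (abs_add_le _ _).trans (by gcongr)
    _ = (m : ℝ)⁻¹ * |∑ k, ε k * ℓ i (y k)| + (m : ℝ)⁻¹ := by ring
    _ ≤ _ := by gcongr

theorem symmetrized_mem_Icc
    (hℓ : ∀ i y, ℓ i y ∈ Set.Icc (0 : ℝ) 1) (z : (Fin m → Y) × (Fin m → Y)) :
    symmetrized ℓ z ∈ Set.Icc (0 : ℝ) 2 := by
  have h : ∀ (σ : Fin m → Bool) y, signedSup ℓ (boolSign ∘ σ) y ∈ Set.Icc (0 : ℝ) 1 :=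
    fun σ y => signedSup_mem_Icc hℓ (fun j => (abs_boolSign _).le) y
  refine ⟨mul_nonneg (by positivity)
    (Finset.sum_nonneg fun σ _ => add_nonneg (h _ _).1 (h _ _).1), ?_⟩
  rw [symmetrized, inv_mul_le_iff₀ (by positivity)]
  refine (Finset.sum_le_card_nsmul _ _ 2 fun σ _ => ?_).trans (by simp)
  linarith [(h σ (select σ z)).2, (h σ (select (fun k => !σ k) z)).2]

/-- Whatever the sign pattern, the difference of the empirical losses on two samples is a
signed sum over each of the two exchanged samples. -/
theorem sum_sub_le_symmetrized
    (hℓ : ∀ i y, ℓ i y ∈ Set.Icc (0 : ℝ) 1) (x x' : Fin m → Y) (i : ι) :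
    (m : ℝ)⁻¹ * ∑ j, (ℓ i (x' j) - ℓ i (x j)) ≤ symmetrized ℓ (x, x') := by
  rw [symmetrized, le_inv_mul_iff₀ (by positivity)]
  refine le_trans (by simp) (Finset.card_nsmul_le_sum Finset.univ _
    ((m : ℝ)⁻¹ * ∑ j, (ℓ i (x' j) - ℓ i (x j))) fun σ _ => ?_)
  have hle : ∀ y : Fin m → Y, (m : ℝ)⁻¹ * |∑ j, (boolSign ∘ σ) j * ℓ i (y j)| ≤
      signedSup ℓ (boolSign ∘ σ) y :=
    fun y => le_ciSup (bddAbove_signedSup hℓ (fun j => (abs_boolSign _).le) y) i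
  have heq : ∑ j, (ℓ i (x' j) - ℓ i (x j)) =
      ∑ j, (boolSign ∘ σ) j * ℓ i (select σ (x, x') j) -
        ∑ j, (boolSign ∘ σ) j * ℓ i (select (fun k => !σ k) (x, x') j) := by
    rw [← Finset.sum_sub_distrib]
    refine Finset.sum_congr rfl fun j _ => ?_
    cases h : σ j <;> simp [select, boolSign, h]
    ring
  refine le_trans ?_ (add_le_add (hle _) (hle _))
  rw [heq, ← mul_add]
  gcongr
  exact (le_abs_self _).trans (abs_sub _ _)

/-- For each sign pattern, only one of the two exchanged samples feels a change of the `j`-th point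
of the first sample. -/
theorem abs_symmetrized_sub_le [Nonempty ι]
    (hℓ : ∀ i y, ℓ i y ∈ Set.Icc (0 : ℝ) 1) (x x' : Fin m → Y) (j : Fin m) (a : Y) :
    |symmetrized ℓ (x, x') - symmetrized ℓ (Function.update x j a, x')| ≤ (m : ℝ)⁻¹ := by
  have hR : ∀ (σ : Fin m → Bool) y, |signedSup ℓ (boolSign ∘ σ) y -
      signedSup ℓ (boolSign ∘ σ) (Function.update y j a)| ≤ (m : ℝ)⁻¹ := by
    intro σ y
    have hε : ∀ j, |(boolSign ∘ σ) j| ≤ 1 := fun j => (abs_boolSign _).le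
    have h1 := signedSup_le_signedSup_add hℓ hε (x := y) (y := Function.update y j a) j
      fun k hk => by simp [hk]
    have h2 := signedSup_le_signedSup_add hℓ hε (x := Function.update y j a) (y := y) j
      fun k hk => by simp [hk]
    exact abs_le.2 ⟨by linarith, by linarith⟩
  rw [symmetrized, symmetrized, ← mul_sub, ← Finset.sum_sub_distrib, abs_mul,
    abs_of_pos (by positivity), inv_mul_le_iff₀ (by positivity)]
  refine (Finset.abs_sum_le_sum_abs _ _).trans
    ((Finset.sum_le_card_nsmul _ _ (m : ℝ)⁻¹ fun σ _ => ?_).trans (by simp))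
  cases h : σ j
  · rw [select_update_of_false h, select_update_of_true (σ := fun k => !σ k) (by simp [h]),
      add_sub_add_right_eq_sub]
    exact hR _ _
  · rw [select_update_of_true h, select_update_of_false (σ := fun k => !σ k) (by simp [h]),
      add_sub_add_left_eq_sub]
    exact hR _ _

variable [MeasurableSpace Y]

theorem integrable_signedSup
    (hℓ : ∀ i y, ℓ i y ∈ Set.Icc (0 : ℝ) 1)
    (ν : Measure Y) [IsProbabilityMeasure ν]
    (hR : ∀ σ : Fin m → Bool,
      AEStronglyMeasurable (signedSup ℓ (boolSign ∘ σ)) (Measure.pi fun _ => ν))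
    (σ : Fin m → Bool) : Integrable (signedSup ℓ (boolSign ∘ σ)) (Measure.pi fun _ => ν) := by
  refine Integrable.of_bound (hR σ) 1 (.of_forall fun y => ?_)
  have := signedSup_mem_Icc hℓ (fun j => (abs_boolSign (σ j)).le) y
  rw [Real.norm_eq_abs, abs_of_nonneg]
  exacts [this.2, this.1]

theorem integrable_symmetrized
    (hℓ : ∀ i y, ℓ i y ∈ Set.Icc (0 : ℝ) 1)
    (ν : Measure Y) [IsProbabilityMeasure ν]
    (hR : ∀ σ : Fin m → Bool,
      AEStronglyMeasurable (signedSup ℓ (boolSign ∘ σ)) (Measure.pi fun _ => ν)) :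
    Integrable (symmetrized ℓ)
      ((Measure.pi fun _ : Fin m => ν).prod (Measure.pi fun _ : Fin m => ν)) := by
  refine Integrable.const_mul (integrable_finsetSum _ fun σ _ => ?_) _
  exact ((measurePreserving_select ν σ).integrable_comp_of_integrable
    (integrable_signedSup hℓ ν hR σ)).add
    ((measurePreserving_select ν fun k => !σ k).integrable_comp_of_integrable
      (integrable_signedSup hℓ ν hR σ))

theorem integral_symmetrized
    (hℓ : ∀ i y, ℓ i y ∈ Set.Icc (0 : ℝ) 1)
    (ν : Measure Y) [IsProbabilityMeasure ν]
    (hR : ∀ σ : Fin m → Bool,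
      AEStronglyMeasurable (signedSup ℓ (boolSign ∘ σ)) (Measure.pi fun _ => ν)) :
    ∫ z, symmetrized ℓ z ∂((Measure.pi fun _ : Fin m => ν).prod (Measure.pi fun _ : Fin m => ν)) =
      2 * (((2 : ℝ) ^ m)⁻¹ * ∑ σ : Fin m → Bool,
        ∫ y, signedSup ℓ (boolSign ∘ σ) y ∂(Measure.pi fun _ => ν)) := by
  have hi : ∀ σ τ : Fin m → Bool, Integrable (fun z => signedSup ℓ (boolSign ∘ σ) (select τ z))
      ((Measure.pi fun _ : Fin m => ν).prod (Measure.pi fun _ : Fin m => ν)) := fun σ τ =>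
    (measurePreserving_select ν τ).integrable_comp_of_integrable (integrable_signedSup hℓ ν hR σ)
  have hv : ∀ σ τ : Fin m → Bool, ∫ z, signedSup ℓ (boolSign ∘ σ) (select τ z)
      ∂((Measure.pi fun _ : Fin m => ν).prod (Measure.pi fun _ : Fin m => ν)) =
      ∫ y, signedSup ℓ (boolSign ∘ σ) y ∂(Measure.pi fun _ => ν) := by
    intro σ τ
    have hmp := measurePreserving_select ν τ
    conv_rhs => rw [← hmp.map_eq]
    rw [integral_map hmp.aemeasurable (by rw [hmp.map_eq]; exact hR σ)]
  have hadd : ∀ σ : Fin m → Bool, Integrable (fun z => signedSup ℓ (boolSign ∘ σ) (select σ z) +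
      signedSup ℓ (boolSign ∘ σ) (select (fun k => !σ k) z))
      ((Measure.pi fun _ : Fin m => ν).prod (Measure.pi fun _ : Fin m => ν)) :=
    fun σ => (hi _ _).add (hi _ _)
  simp only [symmetrized]
  rw [integral_const_mul, integral_finsetSum _ fun σ _ => hadd σ]
  simp only [integral_add (hi _ _) (hi _ _), hv, ← two_mul, ← Finset.mul_sum]
  ring

/-- If all losses have expectation at least `L` and their Rademacher average is at most `ρ`, it is
exponentially unlikely that some loss vanishes on the whole sample. The bound is on an outer
measure, since the event need not be measurable. -/
theorem measure_exists_forall_eq_zero_le [Nonempty ι]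
    (hℓ : ∀ i y, ℓ i y ∈ Set.Icc (0 : ℝ) 1)
    (ν : Measure Y) [IsProbabilityMeasure ν] (hmeas : ∀ i, Measurable (ℓ i)) (hm : 0 < m)
    (hR : ∀ σ : Fin m → Bool,
      AEStronglyMeasurable (signedSup ℓ (boolSign ∘ σ)) (Measure.pi fun _ => ν))
    {L ρ : ℝ} (hL : ∀ i, L ≤ ∫ y, ℓ i y ∂ν)
    (hρ : ((2 : ℝ) ^ m)⁻¹ * ∑ σ : Fin m → Bool,
      ∫ y, signedSup ℓ (boolSign ∘ σ) y ∂(Measure.pi fun _ => ν) ≤ ρ) (hLρ : 2 * ρ ≤ L) :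
    (Measure.pi fun _ : Fin m => ν) {y | ∃ i, ∀ j, ℓ i (y j) = 0} ≤
      ENNReal.ofReal (Real.exp (-(2 * m * (L - 2 * ρ) ^ 2))) := by
  set π : Measure (Fin m → Y) := Measure.pi fun _ => ν with hπ
  have hm' : (0 : ℝ) < m := by exact_mod_cast hm
  have hint := integrable_symmetrized hℓ ν hR
  -- the conditional expectation of the symmetrized supremum given the first sample
  set h : (Fin m → Y) → ℝ := fun x => ∫ x', symmetrized ℓ (x, x') ∂π with hh
  have hh_meas : AEStronglyMeasurable h π := hint.integral_prod_left.aestronglyMeasurable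
  have hh_bdd : ∀ x, |h x| ≤ 2 := by
    intro x
    have := norm_integral_le_of_norm_le_const (μ := π) (f := fun x' => symmetrized ℓ (x, x'))
      (C := 2) (.of_forall fun x' => by
        have := symmetrized_mem_Icc hℓ (x, x')
        rw [Real.norm_eq_abs, abs_of_nonneg this.1]
        exact this.2)
    rwa [probReal_univ, mul_one] at this
  have hT : ∀ᵐ x ∂π, Integrable (fun x' => symmetrized ℓ (x, x')) π := hint.prod_right_ae
  have hEh : ∫ x, h x ∂π ≤ 2 * ρ := by
    rw [hh, ← integral_prod _ hint, integral_symmetrized hℓ ν hR]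
    gcongr
  have hsub : {y : Fin m → Y | ∃ i, ∀ j, ℓ i (y j) = 0} ≤ᵐ[π] {x | L ≤ h x} := by
    filter_upwards [hT] with x hx
    rintro ⟨i, hi⟩
    have hev : ∀ j, Integrable (fun x' : Fin m → Y => ℓ i (x' j)) π := fun j =>
      Integrable.of_bound ((hmeas i).comp (measurable_pi_apply j)).aestronglyMeasurable 1
        (.of_forall fun y => by
          rw [Real.norm_eq_abs, abs_of_nonneg (hℓ i _).1]
          exact (hℓ i _).2)
    calc L ≤ ∫ y, ℓ i y ∂ν := hL i
      _ = ∫ x' : Fin m → Y, (m : ℝ)⁻¹ * ∑ j, (ℓ i (x' j) - ℓ i (x j)) ∂π := by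
        have : ∀ j, ∫ x' : Fin m → Y, ℓ i (x' j) ∂π = ∫ y, ℓ i y ∂ν := fun j =>
          integral_comp_eval (μ := fun _ : Fin m => ν) (hmeas i).aestronglyMeasurable
        simp only [hi, sub_zero]
        rw [integral_const_mul, integral_finsetSum _ fun j _ => hev j]
        simp only [this, Finset.sum_const, Finset.card_univ, Fintype.card_fin, nsmul_eq_mul]
        field_simp
      _ ≤ h x := by
        refine integral_mono (Integrable.const_mul (integrable_finsetSum _ fun j _ => ?_) _) hx
          fun x' => sum_sub_le_symmetrized hℓ x x' i
        exact (hev j).sub (integrable_const _)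
  -- the parameter of the Chernoff bound, chosen to minimize the exponent
  set s : ℝ := 4 * m * (L - 2 * ρ) with hs
  have hs0 : 0 ≤ s := by
    have : 0 ≤ L - 2 * ρ := by linarith
    positivity
  have hmgf : ∫ x, Real.exp (s * h x) ∂π ≤
      Real.exp (s * ∫ x, h x ∂π + m * (s ^ 2 * (m : ℝ)⁻¹ ^ 2 / 8)) := by
    refine integral_exp_le_of_boundedDifferences ν s m h hh_meas hh_bdd hT ?_
    intro x hx j a hxa
    simp only [hh]
    rw [← integral_sub hx hxa]
    have := norm_integral_le_of_norm_le_const (μ := π)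
      (f := fun x' => symmetrized ℓ (x, x') - symmetrized ℓ (Function.update x j a, x'))
      (.of_forall fun x' => abs_symmetrized_sub_le hℓ x x' j a)
    rwa [probReal_univ, mul_one] at this
  have hexp : Integrable (fun x => Real.exp (s * h x)) π := by
    refine Integrable.of_bound (Real.continuous_exp.comp_aestronglyMeasurable
      (hh_meas.const_mul s)) (Real.exp (s * 2)) (.of_forall fun x => ?_)
    rw [Real.norm_eq_abs, Real.abs_exp, Real.exp_le_exp]
    gcongr
    exact (le_abs_self _).trans (hh_bdd x)
  have hcher : π.real {x | L ≤ h x} ≤ Real.exp (-(2 * m * (L - 2 * ρ) ^ 2)) := by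
    refine (measure_ge_le_exp_mul_mgf L hs0 hexp).trans ?_
    rw [mgf]
    refine (mul_le_mul_of_nonneg_left hmgf (Real.exp_nonneg _)).trans ?_
    rw [← Real.exp_add, Real.exp_le_exp]
    have h1 : s * ∫ x, h x ∂π ≤ s * (2 * ρ) := by gcongr
    have h2 : (m : ℝ) * (s ^ 2 * (m : ℝ)⁻¹ ^ 2 / 8) = 2 * m * (L - 2 * ρ) ^ 2 := by
      rw [hs]
      field_simp
      ring
    have h3 : s * (2 * ρ) - s * L = -(4 * m * (L - 2 * ρ) ^ 2) := by
      rw [hs]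
      ring
    rw [h2]
    linarith
  refine (measure_mono_ae hsub).trans ?_
  rw [← ofReal_measureReal]
  exact ENNReal.ofReal_le_ofReal hcher

end Bounds

end Symmetrization

/-! ### The exploration steps of a run -/

section Exploration

variable {d : ℕ} {𝒳 : Set (EuclideanSpace ℝ (Fin d))} {Ω : Type*}

theorem forall_mem_Icc_succ {a b : ℕ} (h : a ≤ b + 1) {q : ℕ → Prop} :
    (∀ i ∈ Finset.Icc a (b + 1), q i) ↔ (∀ i ∈ Finset.Icc a b, q i) ∧ q (b + 1) := by
  refine ⟨fun H => ⟨fun i hi => H i ?_, H _ (Finset.right_mem_Icc.2 h)⟩, fun H i hi => ?_⟩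
  · rw [Finset.mem_Icc] at hi ⊢
    omega
  · rw [Finset.mem_Icc] at hi
    rcases hi.2.eq_or_lt with rfl | hlt
    · exact H.2
    · exact H.1 i (Finset.mem_Icc.2 ⟨hi.1, by omega⟩)

theorem comap_X_le_history (X : ℕ → Ω → 𝒳) (B : ℕ → Ω → Bool) {t i : ℕ}
    (hi : i ∈ Finset.Icc 1 t) :
    MeasurableSpace.comap (X i) inferInstance ≤ history X B t :=
  (le_iSup₂_of_le (f := fun i (_ : i ∈ Finset.Icc 1 t) =>
    MeasurableSpace.comap (X i) inferInstance) i hi le_rfl).trans le_sup_left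

theorem comap_B_le_history (X : ℕ → Ω → 𝒳) (B : ℕ → Ω → Bool) {t i : ℕ}
    (hi : i ∈ Finset.Icc 2 t) :
    MeasurableSpace.comap (B i) inferInstance ≤ history X B t :=
  (le_iSup₂_of_le (f := fun i (_ : i ∈ Finset.Icc 2 t) =>
    MeasurableSpace.comap (B i) inferInstance) i hi le_rfl).trans le_sup_right

/-- The event that the coins up to time `t` follow the pattern `b`. -/
def coinEvent (B : ℕ → Ω → Bool) (b : ℕ → Bool) (t : ℕ) : Set Ω :=
  {ω | ∀ i ∈ Finset.Icc 2 t, B i ω = b i}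

/-- The number of exploration coins showing `true` up to time `t`. -/
def coinCount (B : ℕ → Ω → Bool) (t : ℕ) (ω : Ω) : ℕ :=
  ((Finset.Icc 2 t).filter fun i => B i ω = true).card

theorem coinEvent_eq_iInter (B : ℕ → Ω → Bool) (b : ℕ → Bool) (t : ℕ) :
    coinEvent B b t = ⋂ i ∈ Finset.Icc 2 t, B i ⁻¹' {b i} := by
  ext ω
  simp [coinEvent]

theorem coinEvent_succ (B : ℕ → Ω → Bool) (b : ℕ → Bool) {t : ℕ} (ht : 1 ≤ t) :
    coinEvent B b (t + 1) = coinEvent B b t ∩ B (t + 1) ⁻¹' {b (t + 1)} := by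
  ext ω
  exact forall_mem_Icc_succ (q := fun i => B i ω = b i) (by omega)

theorem measurableSet_history_coinEvent (X : ℕ → Ω → 𝒳) (B : ℕ → Ω → Bool) (b : ℕ → Bool)
    (t : ℕ) : MeasurableSet[history X B t] (coinEvent B b t) := by
  rw [coinEvent_eq_iInter]
  exact Finset.measurableSet_biInter _ fun i hi =>
    comap_B_le_history X B hi _ ⟨_, measurableSet_singleton _, rfl⟩

variable [MeasurableSpace Ω] {P : Measure Ω} {f : 𝒳 → ℝ} {p : ℝ} {R : ℕ → Set (RankingRule 𝒳)}
  {X : ℕ → Ω → 𝒳} {B : ℕ → Ω → Bool} {best : ℕ → Ω → ℕ}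

namespace IsAdaRankOpt

theorem history_le (hrun : IsAdaRankOpt P f p R X B best) (t : ℕ) :
    history X B t ≤ (inferInstance : MeasurableSpace Ω) :=
  sup_le (iSup₂_le fun i hi => (hrun.measurable_X i (Finset.mem_Icc.1 hi).1).comap_le)
    (iSup₂_le fun i hi => (hrun.measurable_B i (Finset.mem_Icc.1 hi).1).comap_le)

/-- Given the past, a point drawn in an exploration step is uniform. -/
theorem measure_inter_explore [IsProbabilityMeasure P]
    [IsProbabilityMeasure (unif (Set.univ : Set 𝒳))]
    (hrun : IsAdaRankOpt P f p R X B best) {t : ℕ} (ht : 1 ≤ t) {F : Set Ω}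
    (hF : MeasurableSet[history X B t] F) {A : Set 𝒳} (hA : MeasurableSet A) :
    P (F ∩ B (t + 1) ⁻¹' {true} ∩ X (t + 1) ⁻¹' A) =
      P (F ∩ B (t + 1) ⁻¹' {true}) * unif Set.univ A := by
  have hB : MeasurableSpace.comap (B (t + 1)) inferInstance ≤ (inferInstance : MeasurableSpace Ω) :=
    (hrun.measurable_B (t + 1) (by omega)).comap_le
  have hm : history X B t ⊔ MeasurableSpace.comap (B (t + 1)) inferInstance ≤
      (inferInstance : MeasurableSpace Ω) := sup_le (hrun.history_le t) hB
  set G := F ∩ B (t + 1) ⁻¹' {true} with hG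
  have hGm : MeasurableSet[history X B t ⊔ MeasurableSpace.comap (B (t + 1)) inferInstance] G :=
    MeasurableSet.inter (le_sup_left (a := history X B t) _ hF)
      (le_sup_right (a := history X B t) _ ⟨_, measurableSet_singleton _, rfl⟩)
  have hXA : MeasurableSet (X (t + 1) ⁻¹' A) := hrun.measurable_X (t + 1) (by omega) hA
  have h1 := setIntegral_condExp (μ := P) hm
    (f := (X (t + 1) ⁻¹' A).indicator fun _ => (1 : ℝ))
    ((integrable_const (1 : ℝ)).indicator hXA) hGm
  have h2 : ∫ ω in G, (P[(X (t + 1) ⁻¹' A).indicator (fun _ => (1 : ℝ)) |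
      history X B t ⊔ MeasurableSpace.comap (B (t + 1)) inferInstance]) ω ∂P =
      ∫ _ in G, (unif (Set.univ : Set 𝒳)).real A ∂P := by
    refine setIntegral_congr_ae (hm _ hGm) ?_
    filter_upwards [hrun.step t ht A hA] with ω hω hωG
    have hb : B (t + 1) ω = true := hωG.2
    rw [hω, if_pos hb]
  rw [h2, setIntegral_const, smul_eq_mul, integral_indicator_const _ hXA, smul_eq_mul, mul_one,
    measureReal_restrict_apply hXA, Set.inter_comm] at h1
  rw [← ofReal_measureReal, ← h1, ENNReal.ofReal_mul measureReal_nonneg, ofReal_measureReal,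
    ofReal_measureReal]

/-- Conditionally on the pattern `b` of the coins, the points drawn in exploration steps are
independent and uniform: only the constraints `A i` at exploration steps may be non-trivial. -/
theorem measure_coinEvent_inter [IsProbabilityMeasure P]
    [IsProbabilityMeasure (unif (Set.univ : Set 𝒳))]
    (hrun : IsAdaRankOpt P f p R X B best) (b : ℕ → Bool) (A : ℕ → Set 𝒳)
    (hA : ∀ i, MeasurableSet (A i)) (hAb : ∀ i, 2 ≤ i → b i = false → A i = Set.univ)
    {t : ℕ} (ht : 1 ≤ t) :
    P (coinEvent B b t ∩ {ω | ∀ i ∈ Finset.Icc 1 t, X i ω ∈ A i}) =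
      P (coinEvent B b t) * ∏ i ∈ Finset.Icc 1 t, unif Set.univ (A i) := by
  induction t, ht using Nat.le_induction with
  | base =>
    have hE : coinEvent B b 1 = Set.univ := by
      ext ω
      simp [coinEvent]
    have hX : {ω | ∀ i ∈ Finset.Icc 1 1, X i ω ∈ A i} = X 1 ⁻¹' A 1 := by
      ext ω
      simp
    rw [hE, hX, Set.univ_inter, ← Measure.map_apply (hrun.measurable_X 1 le_rfl) (hA 1), hrun.init]
    simp
  | succ t ht ih =>
    set F := coinEvent B b t ∩ {ω | ∀ i ∈ Finset.Icc 1 t, X i ω ∈ A i} with hF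
    have hFm : MeasurableSet[history X B t] F := by
      refine MeasurableSet.inter (measurableSet_history_coinEvent X B b t) ?_
      have : {ω | ∀ i ∈ Finset.Icc 1 t, X i ω ∈ A i} = ⋂ i ∈ Finset.Icc 1 t, X i ⁻¹' A i := by
        ext ω
        simp
      rw [this]
      exact Finset.measurableSet_biInter _ fun i hi => comap_X_le_history X B hi _ ⟨_, hA i, rfl⟩
    have hindep : ∀ G, MeasurableSet[history X B t] G →
        P (G ∩ B (t + 1) ⁻¹' {b (t + 1)}) = P G * P (B (t + 1) ⁻¹' {b (t + 1)}) := by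
      intro G hG
      rw [Set.inter_comm, mul_comm]
      exact (Indep_iff _ _ P).1 (hrun.indep t ht) _ _ ⟨_, measurableSet_singleton _, rfl⟩ hG
    have hsplit : coinEvent B b (t + 1) ∩ {ω | ∀ i ∈ Finset.Icc 1 (t + 1), X i ω ∈ A i} =
        F ∩ B (t + 1) ⁻¹' {b (t + 1)} ∩ X (t + 1) ⁻¹' A (t + 1) := by
      have : {ω | ∀ i ∈ Finset.Icc 1 (t + 1), X i ω ∈ A i} =
          {ω | ∀ i ∈ Finset.Icc 1 t, X i ω ∈ A i} ∩ X (t + 1) ⁻¹' A (t + 1) := by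
        ext ω
        exact forall_mem_Icc_succ (q := fun i => X i ω ∈ A i) (by omega)
      rw [coinEvent_succ B b ht, this, hF, ← Set.inter_assoc,
        Set.inter_right_comm (coinEvent B b t)]
    have hlast : P (F ∩ B (t + 1) ⁻¹' {b (t + 1)} ∩ X (t + 1) ⁻¹' A (t + 1)) =
        P (F ∩ B (t + 1) ⁻¹' {b (t + 1)}) * unif Set.univ (A (t + 1)) := by
      cases hb : b (t + 1) with
      | true => exact hrun.measure_inter_explore ht hFm (hA _)
      | false => simp [hAb (t + 1) (by omega) hb]
    rw [hsplit, hlast, hindep F hFm, ih, coinEvent_succ B b ht,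
      hindep _ (measurableSet_history_coinEvent X B b t), Finset.prod_Icc_succ_top (by omega)]
    ring

/-- Conditionally on the pattern `b` of the coins, any points drawn at distinct exploration steps
form an i.i.d. uniform sample. -/
theorem map_cond_coinEvent [IsProbabilityMeasure P]
    [IsProbabilityMeasure (unif (Set.univ : Set 𝒳))]
    (hrun : IsAdaRankOpt P f p R X B best) (b : ℕ → Bool) {t : ℕ} (ht : 1 ≤ t)
    (hb : P (coinEvent B b t) ≠ 0) {κ : Type*} [Fintype κ] {e : κ → ℕ}
    (he : Function.Injective e) (het : ∀ j, e j ∈ Finset.Icc 1 t)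
    (heb : ∀ j, 2 ≤ e j → b (e j) = true) :
    (ProbabilityTheory.cond P (coinEvent B b t)).map (fun ω j => X (e j) ω) =
      Measure.pi fun _ => unif Set.univ := by
  classical
  have hXm : Measurable fun ω (j : κ) => X (e j) ω :=
    measurable_pi_lambda _ fun j => hrun.measurable_X _ (Finset.mem_Icc.1 (het j)).1
  have hEm : MeasurableSet (coinEvent B b t) :=
    hrun.history_le t _ (measurableSet_history_coinEvent X B b t)
  refine (Measure.pi_eq fun s hs => ?_).symm
  rw [Measure.map_apply hXm (MeasurableSet.univ_pi hs), cond_apply hEm]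
  set A : ℕ → Set 𝒳 := fun i => ⋂ (j : κ) (_ : e j = i), s j with hA
  have hAm : ∀ i, MeasurableSet (A i) := fun i =>
    MeasurableSet.iInter fun j => MeasurableSet.iInter fun _ => hs j
  have hAe : ∀ j, A (e j) = s j := by
    intro j
    ext y
    simp only [hA, Set.mem_iInter]
    exact ⟨fun h => h j rfl, fun h k hk => he hk ▸ h⟩
  have hAuniv : ∀ i, (∀ j, e j ≠ i) → A i = Set.univ := by
    intro i hi
    refine Set.eq_univ_of_forall fun y => ?_
    simp only [hA, Set.mem_iInter]
    exact fun j hj => absurd hj (hi j)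
  have hset : coinEvent B b t ∩ (fun ω (j : κ) => X (e j) ω) ⁻¹' Set.univ.pi s =
      coinEvent B b t ∩ {ω | ∀ i ∈ Finset.Icc 1 t, X i ω ∈ A i} := by
    ext ω
    refine and_congr_right fun _ => ?_
    simp only [Set.mem_preimage, Set.mem_pi, Set.mem_univ, forall_const]
    refine ⟨fun h i _ => ?_, fun h j => hAe j ▸ h _ (het j)⟩
    simp only [hA, Set.mem_iInter]
    rintro j rfl
    exact h j
  rw [hset, hrun.measure_coinEvent_inter b A hAm (fun i hi hbi => hAuniv i fun j hj => by
    have := heb j (hj ▸ hi)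
    rw [hj, hbi] at this
    exact Bool.false_ne_true this) ht, ← mul_assoc, ENNReal.inv_mul_cancel hb (measure_ne_top _ _),
    one_mul]
  have hsub : Finset.univ.image e ⊆ Finset.Icc 1 t := by
    intro i hi
    obtain ⟨j, _, rfl⟩ := Finset.mem_image.1 hi
    exact het j
  rw [← Finset.prod_subset hsub, Finset.prod_image he.injOn]
  · exact Finset.prod_congr rfl fun j _ => by rw [hAe]
  · intro i _ hi
    rw [hAuniv i fun j hj => hi (hj ▸ Finset.mem_image_of_mem e (Finset.mem_univ j)), measure_univ]

/-- If an event forces every sample of `n` points among the exploration points up to time `t` to lie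
in `D`, and there are at least `n` exploration points, then it is at most as likely as
`D` under the law of `n` i.i.d. uniform points. -/
theorem measure_forall_explore_mem_le [IsProbabilityMeasure P]
    [IsProbabilityMeasure (unif (Set.univ : Set 𝒳))]
    (hrun : IsAdaRankOpt P f p R X B best) {t n : ℕ} (ht : 1 ≤ t) (D : Set (Fin n → 𝒳)) :
    P {ω | n ≤ coinCount B t ω + 1 ∧ ∀ e : Fin n → ℕ, StrictMono e →
        (∀ j, e j ∈ Finset.Icc 1 t) → (fun j => X (e j) ω) ∈ D} ≤
      (Measure.pi fun _ => unif Set.univ) D := by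
  classical
  set π : Measure (Fin n → 𝒳) := Measure.pi fun _ => unif Set.univ with hπ
  set Bad : Set Ω := {ω | n ≤ coinCount B t ω + 1 ∧ ∀ e : Fin n → ℕ, StrictMono e →
        (∀ j, e j ∈ Finset.Icc 1 t) → (fun j => X (e j) ω) ∈ D} with hBad
  -- the coin patterns up to time `t` are indexed by the sets of exploration steps
  set E : Finset ℕ → Set Ω := fun S => coinEvent B (fun i => decide (i ∈ S)) t with hE
  have hEm : ∀ S, MeasurableSet (E S) := fun S =>
    hrun.history_le t _ (measurableSet_history_coinEvent X B _ t)
  have hEfilter : ∀ S ∈ (Finset.Icc 2 t).powerset, ∀ ω ∈ E S,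
      (Finset.Icc 2 t).filter (fun i => B i ω = true) = S := by
    intro S hS ω hω
    ext i
    rw [Finset.mem_filter]
    refine ⟨fun h => by simpa [hω i h.1] using h.2, fun h => ?_⟩
    have hi := Finset.mem_powerset.1 hS h
    exact ⟨hi, by simpa [hω i hi] using h⟩
  have hdisj : Set.PairwiseDisjoint ((Finset.Icc 2 t).powerset : Set (Finset ℕ)) E := by
    intro S hS S' hS' hne
    refine Set.disjoint_left.2 fun ω hω hω' => hne ?_
    rw [← hEfilter S hS ω hω, hEfilter S' hS' ω hω']
  have hcover : Bad ⊆ ⋃ S ∈ (Finset.Icc 2 t).powerset, E S ∩ Bad := by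
    intro ω hω
    refine Set.mem_biUnion (x := (Finset.Icc 2 t).filter fun i => B i ω = true)
      (Finset.mem_powerset.2 (Finset.filter_subset _ _)) ⟨fun i hi => ?_, hω⟩
    simp [(Finset.mem_Icc.1 hi).1, (Finset.mem_Icc.1 hi).2]
  have hpiece : ∀ S ∈ (Finset.Icc 2 t).powerset, P (E S ∩ Bad) ≤ P (E S) * π D := by
    intro S hS
    by_cases hcard : n ≤ S.card + 1
    · by_cases h0 : P (E S) = 0
      · rw [measure_mono_null Set.inter_subset_left h0]
        exact zero_le
      have h1S : 1 ∉ S := fun h => by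
        have := Finset.mem_Icc.1 (Finset.mem_powerset.1 hS h)
        omega
      obtain ⟨S', hS', hcard'⟩ := Finset.exists_subset_card_eq
        (show n ≤ (insert 1 S).card by rwa [Finset.card_insert_of_notMem h1S])
      set e := S'.orderEmbOfFin hcard' with he
      have hemem : ∀ j, e j ∈ insert 1 S := fun j => hS' (S'.orderEmbOfFin_mem hcard' j)
      have het : ∀ j, e j ∈ Finset.Icc 1 t := by
        intro j
        rcases Finset.mem_insert.1 (hemem j) with h | h
        · rw [h]
          exact Finset.mem_Icc.2 ⟨le_rfl, ht⟩
        · have := Finset.mem_Icc.1 (Finset.mem_powerset.1 hS h)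
          exact Finset.mem_Icc.2 ⟨by omega, this.2⟩
      have hXm : Measurable fun ω (j : Fin n) => X (e j) ω :=
        measurable_pi_lambda _ fun j => hrun.measurable_X _ (Finset.mem_Icc.1 (het j)).1
      have hlaw := hrun.map_cond_coinEvent (fun i => decide (i ∈ S)) ht h0 e.injective het
        (fun j hj => by
          rcases Finset.mem_insert.1 (hemem j) with h | h
          · omega
          · simpa using h)
      calc P (E S ∩ Bad)
          ≤ P (E S ∩ (fun ω (j : Fin n) => X (e j) ω) ⁻¹' toMeasurable π D) := by
            refine measure_mono fun ω hω => ⟨hω.1, subset_toMeasurable _ _ ?_⟩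
            exact hω.2.2 e e.strictMono het
        _ = P (E S) * π (toMeasurable π D) := by
            rw [hπ, ← hlaw, Measure.map_apply hXm (measurableSet_toMeasurable _ _), mul_comm,
              hE, cond_mul_eq_inter (hEm S)]
        _ = P (E S) * π D := by rw [measure_toMeasurable]
    · have : E S ∩ Bad = ∅ := by
        refine Set.eq_empty_of_forall_notMem fun ω hω => hcard ?_
        have := hω.2.1
        rwa [coinCount, hEfilter S hS ω hω.1] at this
      simp [this]
  calc P Bad ≤ ∑ S ∈ (Finset.Icc 2 t).powerset, P (E S ∩ Bad) :=
        (measure_mono hcover).trans (measure_biUnion_finset_le _ _)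
    _ ≤ ∑ S ∈ (Finset.Icc 2 t).powerset, P (E S) * π D := Finset.sum_le_sum hpiece
    _ = P (⋃ S ∈ (Finset.Icc 2 t).powerset, E S) * π D := by
        rw [← Finset.sum_mul, measure_biUnion_finset hdisj fun S _ => hEm S]
    _ ≤ π D := mul_le_of_le_one_left zero_le prob_le_one

/-- The Laplace transform at `log 2` of the number of exploration coins. -/
theorem lintegral_prod_coin [IsProbabilityMeasure P] (hp : p ∈ Set.Ioo (0 : ℝ) 1)
    (hrun : IsAdaRankOpt P f p R X B best) {t : ℕ} (ht : 1 ≤ t) :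
    ∫⁻ ω, ∏ i ∈ Finset.Icc 2 t, (if B i ω = true then (2 : ℝ≥0∞)⁻¹ else 1) ∂P =
      ENNReal.ofReal (1 - p / 2) ^ (t - 1) := by
  induction t, ht using Nat.le_induction with
  | base => simp
  | succ t ht ih =>
    have hfac : ∀ m : MeasurableSpace Ω, ∀ i, Measurable[m] (B i) →
        Measurable[m] fun ω => if B i ω = true then (2 : ℝ≥0∞)⁻¹ else 1 := fun m i hi =>
      (measurable_of_countable fun b : Bool => if b = true then (2 : ℝ≥0∞)⁻¹ else 1).comp hi
    have hB : Measurable (B (t + 1)) := hrun.measurable_B (t + 1) (by omega)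
    have hcoin : ∫⁻ ω, (if B (t + 1) ω = true then (2 : ℝ≥0∞)⁻¹ else 1) ∂P =
        ENNReal.ofReal (1 - p / 2) := by
      have hT : MeasurableSet {ω | B (t + 1) ω = true} := hB (measurableSet_singleton true)
      have hsplit : ∀ ω, (if B (t + 1) ω = true then (2 : ℝ≥0∞)⁻¹ else 1) =
          {ω | B (t + 1) ω = true}.indicator (fun _ => (2 : ℝ≥0∞)⁻¹) ω +
          {ω | B (t + 1) ω = true}ᶜ.indicator (fun _ => 1) ω := by
        intro ω
        by_cases h : B (t + 1) ω = true <;> simp [h]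
      simp only [hsplit]
      rw [lintegral_add_left (measurable_const.indicator hT), lintegral_indicator_const hT,
        lintegral_indicator_const hT.compl, prob_compl_eq_one_sub hT, hrun.bernoulli t ht,
        one_mul, ← ENNReal.ofReal_one, ← ENNReal.ofReal_sub _ hp.1.le,
        show (2 : ℝ≥0∞)⁻¹ = ENNReal.ofReal (2⁻¹) by
          rw [ENNReal.ofReal_inv_of_pos two_pos]; simp,
        ← ENNReal.ofReal_mul (by norm_num), ← ENNReal.ofReal_add (by linarith [hp.1])
          (by linarith [hp.2])]
      congr 1
      ring
    simp only [Finset.prod_Icc_succ_top (show 2 ≤ t + 1 by omega)]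
    rw [lintegral_mul_eq_lintegral_mul_lintegral_of_independent_measurableSpace
      (hrun.history_le t) hB.comap_le (hrun.indep t ht).symm
      (Finset.measurable_fun_prod _ fun i hi => hfac _ i
        (measurable_iff_comap_le.2 (comap_B_le_history X B hi)))
      (hfac _ _ (comap_measurable _)), ih, hcoin, ← pow_succ]
    congr 1
    omega

/-- Chernoff bound for the number of exploration coins. -/
theorem measure_coinCount_le [IsProbabilityMeasure P] (hp : p ∈ Set.Ioo (0 : ℝ) 1)
    (hrun : IsAdaRankOpt P f p R X B best) {t : ℕ} (ht : 1 ≤ t) (a : ℕ) :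
    P {ω | coinCount B t ω ≤ a} ≤
      ENNReal.ofReal (2 ^ a * Real.exp (-(p * (t - 1) / 2))) := by
  have hmeas : Measurable fun ω =>
      ∏ i ∈ Finset.Icc 2 t, (if B i ω = true then (2 : ℝ≥0∞)⁻¹ else 1) :=
    Finset.measurable_fun_prod _ fun i hi =>
      (measurable_of_countable fun b : Bool => if b = true then (2 : ℝ≥0∞)⁻¹ else 1).comp
        (hrun.measurable_B i (Finset.mem_Icc.1 hi).1)
  have hsub : {ω | coinCount B t ω ≤ a} ⊆ {ω | (2 : ℝ≥0∞)⁻¹ ^ a ≤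
      ∏ i ∈ Finset.Icc 2 t, (if B i ω = true then (2 : ℝ≥0∞)⁻¹ else 1)} := by
    intro ω hω
    rw [Set.mem_ofPred_eq, Finset.prod_ite, Finset.prod_const, Finset.prod_const_one, mul_one]
    exact pow_le_pow_right_of_le_one' (by simp) hω
  have h := (mul_meas_ge_le_lintegral hmeas ((2 : ℝ≥0∞)⁻¹ ^ a)).trans_eq
    (hrun.lintegral_prod_coin hp ht)
  have hpow : ENNReal.ofReal (1 - p / 2) ^ (t - 1) ≤
      ENNReal.ofReal (Real.exp (-(p * (t - 1) / 2))) := by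
    rw [← ENNReal.ofReal_pow (by linarith [hp.2])]
    refine ENNReal.ofReal_le_ofReal ?_
    have hexp : Real.exp (-(p * (t - 1) / 2)) = Real.exp (-(p / 2)) ^ (t - 1) := by
      rw [← Real.exp_nat_mul, Nat.cast_sub ht]
      congr 1
      push_cast
      ring
    rw [hexp]
    refine pow_le_pow_left₀ (by linarith [hp.2]) ?_ _
    linarith [Real.add_one_le_exp (-(p / 2))]
  calc P {ω | coinCount B t ω ≤ a}
      ≤ 2 ^ a * ((2 : ℝ≥0∞)⁻¹ ^ a * P {ω | (2 : ℝ≥0∞)⁻¹ ^ a ≤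
          ∏ i ∈ Finset.Icc 2 t, (if B i ω = true then (2 : ℝ≥0∞)⁻¹ else 1)}) := by
        rw [← mul_assoc, ← mul_pow, ENNReal.mul_inv_cancel two_ne_zero ENNReal.ofNat_ne_top,
          one_pow, one_mul]
        exact measure_mono hsub
    _ ≤ 2 ^ a * ENNReal.ofReal (Real.exp (-(p * (t - 1) / 2))) := by
        gcongr
        exact h.trans hpow
    _ = _ := by
        rw [ENNReal.ofReal_mul (by positivity), ENNReal.ofReal_pow (by norm_num)]
        simp

end IsAdaRankOpt

end Exploration

/-! ### Rademacher averages -/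

instance : IsProbabilityMeasure rademacher :=
  ⟨by simp [rademacher, ENNReal.inv_two_add_inv_two]⟩

theorem rademacher_singleton_boolSign (b : Bool) : rademacher {boolSign b} = 2⁻¹ := by
  have h : ¬ (1 : ℝ) = -1 := by norm_num
  have h' : ¬ (-1 : ℝ) = 1 := by norm_num
  cases b <;> simp [rademacher, boolSign, h, h']

/-- A vector of Rademacher signs is uniform over the sign patterns. -/
theorem pi_rademacher_eq_sum_dirac (m : ℕ) :
    (Measure.pi fun _ : Fin m => rademacher) =
      ∑ σ : Fin m → Bool, ((2 : ℝ≥0∞) ^ m)⁻¹ • Measure.dirac (boolSign ∘ σ) := by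
  refine Measure.pi_eq fun s hs => ?_
  have h1 : ∀ j, rademacher (s j) =
      ∑ b : Bool, (2 : ℝ≥0∞)⁻¹ * (s j).indicator 1 (boolSign b) := by
    intro j
    simp [rademacher, boolSign, hs j]
  simp only [h1, Finset.prod_univ_sum, Fintype.piFinset_univ, Finset.prod_mul_distrib,
    Finset.prod_const, Finset.card_univ, Fintype.card_fin, Measure.coe_finsetSum, Finset.sum_apply,
    Measure.smul_apply, smul_eq_mul, ENNReal.inv_pow]
  refine Finset.sum_congr rfl fun σ _ => ?_
  congr 1
  rw [Measure.dirac_apply' _ (MeasurableSet.univ_pi hs)]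
  by_cases h : boolSign ∘ σ ∈ Set.univ.pi s
  · have h' : ∀ j, boolSign (σ j) ∈ s j := fun j => h j (Set.mem_univ j)
    simp [h, h']
  · have h' : ∃ j, boolSign (σ j) ∉ s j := by
      by_contra hcon
      push Not at hcon
      exact h fun j _ => hcon j
    obtain ⟨j, hj⟩ := h'
    rw [Set.indicator_of_notMem h, Finset.prod_eq_zero (Finset.mem_univ j)]
    simp [hj]

/-- Integrability over the Rademacher signs is integrability for each sign pattern. -/
theorem integrable_boolSign_of_prod {α : Type*} [MeasurableSpace α] {μ : Measure α} [SFinite μ]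
    {m : ℕ} {F : α × (Fin m → ℝ) → ℝ}
    (hF : Integrable F (μ.prod (Measure.pi fun _ => rademacher))) (σ : Fin m → Bool) :
    Integrable (fun x => F (x, boolSign ∘ σ)) μ := by
  by_contra hcon
  have h := hF.prod_left_ae
  rw [ae_iff] at h
  have h0 : (Measure.pi fun _ : Fin m => rademacher) {boolSign ∘ σ} = 0 :=
    measure_mono_null (Set.singleton_subset_iff.2 hcon) h
  rw [Measure.pi_singleton] at h0
  simp [rademacher_singleton_boolSign] at h0

theorem integral_prod_rademacher {α : Type*} [MeasurableSpace α] {μ : Measure α} [SFinite μ]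
    {m : ℕ} {F : α × (Fin m → ℝ) → ℝ}
    (hF : Integrable F (μ.prod (Measure.pi fun _ => rademacher))) :
    ∫ z, F z ∂(μ.prod (Measure.pi fun _ => rademacher)) =
      ((2 : ℝ) ^ m)⁻¹ * ∑ σ : Fin m → Bool, ∫ x, F (x, boolSign ∘ σ) ∂μ := by
  rw [integral_prod_symm _ hF, pi_rademacher_eq_sum_dirac, integral_finsetSum_measure]
  · simp only [integral_smul_measure, integral_dirac, ← Finset.smul_sum]
    simp
  · intro σ _
    exact (integrable_dirac (by simp)).smul_measure (by simp)

variable {d : ℕ} {𝒳 : Set (EuclideanSpace ℝ (Fin d))}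

/-- The loss of a ranking rule at a pair of points: `1` if it disagrees with `r_f` and
`0` otherwise. -/
noncomputable def rankLoss (f : 𝒳 → ℝ) (r : RankingRule 𝒳) (y : 𝒳 × 𝒳) : ℝ :=
  if r y.1 y.2 ≠ inducedRule f y.1 y.2 then 1 else 0

theorem rankLoss_mem_Icc (f : 𝒳 → ℝ) (r : RankingRule 𝒳) (y : 𝒳 × 𝒳) :
    rankLoss f r y ∈ Set.Icc (0 : ℝ) 1 := by
  rw [rankLoss]
  split_ifs <;> simp

/-- The pairs formed by the `i`-th and the `(n / 2 + i)`-th of `n` points. -/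
def pairs (n : ℕ) (z : Fin n → 𝒳) (i : Fin (n / 2)) : 𝒳 × 𝒳 :=
  (z ⟨i, by omega⟩, z ⟨n / 2 + i, by omega⟩)

/-- The right inverse of `pairs` when `n` is even. -/
def unpair {n : ℕ} (hn : Even n) (y : Fin (n / 2) → 𝒳 × 𝒳) (k : Fin n) : 𝒳 :=
  if h : k < n / 2 then (y ⟨k, h⟩).1
  else (y ⟨k - n / 2, by obtain ⟨m, rfl⟩ := hn; omega⟩).2

theorem pairs_unpair {n : ℕ} (hn : Even n) (y : Fin (n / 2) → 𝒳 × 𝒳) :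
    pairs n (unpair hn y) = y := by
  ext i : 1
  simp [pairs, unpair]

theorem rademacherAvg_eq_signedSup (f : 𝒳 → ℝ) (M : Set (RankingRule 𝒳)) (n : ℕ)
    (z : Fin n → 𝒳) (ε : Fin (n / 2) → ℝ) :
    rademacherAvg f M n (z, ε) = signedSup (fun r : M => rankLoss f r.1) ε (pairs n z) := rfl

theorem measurePreserving_unpair {n : ℕ} (hn : Even n) (μ : Measure 𝒳) [IsProbabilityMeasure μ] :
    MeasurePreserving (unpair hn) (Measure.pi fun _ => μ.prod μ) (Measure.pi fun _ => μ) := by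
  have he : Function.Injective (fun k : Fin n => if h : k < n / 2 then Sum.inl ⟨k, h⟩
      else (Sum.inr ⟨k - n / 2, by obtain ⟨m, rfl⟩ := hn; omega⟩ : Fin (n / 2) ⊕ Fin (n / 2))) := by
    intro a b hab
    by_cases ha : (a : ℕ) < n / 2 <;> by_cases hb : (b : ℕ) < n / 2 <;>
      simp [ha, hb] at hab <;> omega
  convert! ((measurePreserving_comp_injective μ he).comp
    (measurePreserving_sumPiEquivProdPi_symm (X := fun _ : Fin (n / 2) ⊕ Fin (n / 2) => 𝒳)
      fun _ => μ)).comp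
    (measurePreserving_arrowProdEquivProdArrow 𝒳 𝒳 (Fin (n / 2)) (fun _ => μ) fun _ => μ) using 1
  ext y k : 2
  by_cases h : (k : ℕ) < n / 2 <;> simp [unpair, h, MeasurableEquiv.sumPiEquivProdPi,
    Equiv.sumPiEquivProdPi, MeasurableEquiv.arrowProdEquivProdArrow, Equiv.arrowProdEquivProdArrow]

theorem measurePreserving_pairs {n : ℕ} (hn : Even n) (μ : Measure 𝒳) [IsProbabilityMeasure μ] :
    MeasurePreserving (pairs n) (Measure.pi fun _ => μ) (Measure.pi fun _ => μ.prod μ) := by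
  have hm : Measurable (pairs n : (Fin n → 𝒳) → _) := by
    unfold pairs
    fun_prop
  refine ⟨hm, ?_⟩
  rw [← (measurePreserving_unpair hn μ).map_eq,
    Measure.map_map hm (measurePreserving_unpair hn μ).measurable]
  have : pairs n ∘ unpair hn = (id : (Fin (n / 2) → 𝒳 × 𝒳) → _) := funext fun y => pairs_unpair hn y
  rw [this, Measure.map_id]

theorem integral_comp_pairs {n : ℕ} (hn : Even n) (μ : Measure 𝒳) [IsProbabilityMeasure μ]
    {g : (Fin (n / 2) → 𝒳 × 𝒳) → ℝ}
    (hg : AEStronglyMeasurable g (Measure.pi fun _ => μ.prod μ)) :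
    ∫ z, g (pairs n z) ∂(Measure.pi fun _ => μ) = ∫ y, g y ∂(Measure.pi fun _ => μ.prod μ) := by
  have h := measurePreserving_pairs hn μ
  conv_rhs => rw [← h.map_eq]
  rw [integral_map h.aemeasurable (by rwa [h.map_eq])]

section Transfer

variable [IsProbabilityMeasure (unif (Set.univ : Set 𝒳))] {f : 𝒳 → ℝ} {M : Set (RankingRule 𝒳)}
  {n : ℕ}

theorem aestronglyMeasurable_signedSup_of_rademacherAvg (hn : Even n)
    (hint : Integrable (rademacherAvg f M n) (rademacherLaw 𝒳 n)) (σ : Fin (n / 2) → Bool) :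
    AEStronglyMeasurable (signedSup (fun r : M => rankLoss f r.1) (boolSign ∘ σ))
      (Measure.pi fun _ => (unif (Set.univ : Set 𝒳)).prod (unif Set.univ)) := by
  have h := (integrable_boolSign_of_prod hint σ).aestronglyMeasurable.comp_measurePreserving
    (measurePreserving_unpair hn (unif (Set.univ : Set 𝒳)))
  refine h.congr (.of_forall fun y => ?_)
  simp only [Function.comp, rademacherAvg_eq_signedSup, pairs_unpair]

theorem integral_rademacherAvg (hn : Even n)
    (hint : Integrable (rademacherAvg f M n) (rademacherLaw 𝒳 n)) :
    ∫ z, rademacherAvg f M n z ∂(rademacherLaw 𝒳 n) =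
      ((2 : ℝ) ^ (n / 2))⁻¹ * ∑ σ : Fin (n / 2) → Bool,
        ∫ y, signedSup (fun r : M => rankLoss f r.1) (boolSign ∘ σ) y
          ∂(Measure.pi fun _ => (unif (Set.univ : Set 𝒳)).prod (unif Set.univ)) := by
  rw [rademacherLaw, integral_prod_rademacher hint]
  congr 1
  refine Finset.sum_congr rfl fun σ _ => ?_
  rw [← integral_comp_pairs hn _ (aestronglyMeasurable_signedSup_of_rademacherAvg hn hint σ)]
  rfl

end Transfer

/-- For a single observation, the Rademacher average is at least the expected loss. -/
theorem le_integral_signedSup_of_eq_one {ι Y : Type*} {ℓ : ι → Y → ℝ}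
    (hℓ : ∀ i y, ℓ i y ∈ Set.Icc (0 : ℝ) 1) [MeasurableSpace Y] (ν : Measure Y)
    [IsProbabilityMeasure ν] (hmeas : ∀ i, Measurable (ℓ i)) {m : ℕ} (hm : m = 1)
    (hR : ∀ σ : Fin m → Bool,
      AEStronglyMeasurable (signedSup ℓ (boolSign ∘ σ)) (Measure.pi fun _ => ν)) (i : ι) :
    ∫ y, ℓ i y ∂ν ≤ ((2 : ℝ) ^ m)⁻¹ * ∑ σ : Fin m → Bool,
      ∫ y, signedSup ℓ (boolSign ∘ σ) y ∂(Measure.pi fun _ => ν) := by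
  subst hm
  have h : ∀ σ : Fin 1 → Bool, ∫ y, ℓ i y ∂ν ≤
      ∫ y, signedSup ℓ (boolSign ∘ σ) y ∂(Measure.pi fun _ => ν) := by
    intro σ
    rw [← integral_comp_eval (μ := fun _ : Fin 1 => ν) (i := 0) (hmeas i).aestronglyMeasurable]
    refine integral_mono_of_nonneg (.of_forall fun y => (hℓ i _).1)
      (integrable_signedSup hℓ ν hR σ) (.of_forall fun y => ?_)
    have := le_ciSup (bddAbove_signedSup hℓ (fun j => (abs_boolSign (σ j)).le) y) i
    refine le_trans (le_of_eq ?_) this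
    simp [abs_mul, abs_boolSign, abs_of_nonneg (hℓ i (y 0)).1]
  rw [le_inv_mul_iff₀ (by positivity)]
  refine le_trans (by simp) (Finset.card_nsmul_le_sum Finset.univ _ (∫ y, ℓ i y ∂ν) fun σ _ => h σ)

/-! ### Ranking losses -/

theorem isProbabilityMeasure_unif_univ (hc : IsCompact 𝒳) (hint : (interior 𝒳).Nonempty) :
    IsProbabilityMeasure (unif (Set.univ : Set 𝒳)) := by
  have h : (Measure.comap Subtype.val volume : Measure 𝒳) Set.univ = volume 𝒳 := by
    rw [(MeasurableEmbedding.subtype_coe hc.measurableSet).comap_apply]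
    simp
  refine cond_isProbabilityMeasure_of_finite ?_ ?_
  · rw [h]
    exact ((isOpen_interior.measure_pos volume hint).trans_le (measure_mono interior_subset)).ne'
  · rw [h]
    exact hc.measure_ne_top

theorem measurableSet_sign_eq_sign {α : Type*} [MeasurableSpace α] {u v : α → ℝ}
    (hu : Measurable u) (hv : Measurable v) :
    MeasurableSet {x | SignType.sign (u x) = SignType.sign (v x)} := by
  have h : {x | SignType.sign (u x) = SignType.sign (v x)} =
      ({x | 0 < u x} ∩ {x | 0 < v x}) ∪ ({x | u x < 0} ∩ {x | v x < 0}) ∪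
        ({x | u x = 0} ∩ {x | v x = 0}) := by
    ext x
    rcases lt_trichotomy (u x) 0 with hu' | hu' | hu' <;>
      rcases lt_trichotomy (v x) 0 with hv' | hv' | hv' <;>
      simp [hu', hv', not_lt_of_gt, LT.lt.ne, LT.lt.ne']
  rw [h]
  measurability

theorem measurable_rankLoss {f : 𝒳 → ℝ} {r : RankingRule 𝒳}
    (hf : inducedRule f ∈ continuousRules 𝒳) (hr : r ∈ continuousRules 𝒳) :
    Measurable (rankLoss f r) := by
  obtain ⟨g, hg, hfg⟩ := hf
  obtain ⟨h, hh, rfl⟩ := hr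
  refine Measurable.ite ?_ measurable_const measurable_const
  rw [hfg]
  exact (measurableSet_sign_eq_sign (u := fun y : 𝒳 × 𝒳 => h y.1 - h y.2)
    (v := fun y : 𝒳 × 𝒳 => g y.1 - g y.2) (by fun_prop) (by fun_prop)).compl

theorem integral_rankLoss {f : 𝒳 → ℝ} {r : RankingRule 𝒳} (h : Measurable (rankLoss f r)) :
    ∫ y, rankLoss f r y ∂((unif (Set.univ : Set 𝒳)).prod (unif Set.univ)) = trueLoss f r := by
  have hset : MeasurableSet {z : 𝒳 × 𝒳 | r z.1 z.2 ≠ inducedRule f z.1 z.2} := by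
    have : {z : 𝒳 × 𝒳 | r z.1 z.2 ≠ inducedRule f z.1 z.2} = rankLoss f r ⁻¹' {1} := by
      ext z
      by_cases hz : r z.1 z.2 = inducedRule f z.1 z.2 <;> simp [rankLoss, hz]
    rw [this]
    exact h (measurableSet_singleton _)
  rw [trueLoss, ← integral_indicator_one hset]
  refine integral_congr_ae (.of_forall fun z => ?_)
  by_cases hz : r z.1 z.2 = inducedRule f z.1 z.2 <;> simp [rankLoss, hz]

/-- A rule with zero empirical loss is consistent with `r_f` on all pairs of the sample. -/
theorem eq_inducedRule_of_empLoss_eq_zero {f : 𝒳 → ℝ} {x : ℕ → 𝒳} {t : ℕ} {r : RankingRule 𝒳}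
    (h : empLoss f x t r = 0) {i j : ℕ} (hi : 1 ≤ i) (hij : i < j) (hj : j ≤ t) :
    r (x i) (x j) = inducedRule f (x i) (x j) := by
  have ht : (1 : ℝ) < t := by exact_mod_cast (by omega : 1 < t)
  have hne : (2 : ℝ) / ((t : ℝ) * ((t : ℝ) - 1)) ≠ 0 := by
    have : (t : ℝ) - 1 ≠ 0 := by linarith
    positivity
  have hsum := (mul_eq_zero.1 h).resolve_left hne
  have hnn : ∀ i j, (0 : ℝ) ≤ if r (x i) (x j) ≠ inducedRule f (x i) (x j) then 1 else 0 := by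
    intro i j
    split_ifs <;> simp
  rw [Finset.sum_eq_zero_iff_of_nonneg fun j _ => Finset.sum_nonneg fun i _ => hnn i j] at hsum
  have hsum' := hsum j (Finset.mem_Icc.2 ⟨by omega, hj⟩)
  rw [Finset.sum_eq_zero_iff_of_nonneg fun i _ => hnn i j] at hsum'
  have := hsum' i (Finset.mem_Ico.2 ⟨hi, hij⟩)
  by_contra hcon
  simp [hcon] at this

theorem empLoss_inducedRule (f : 𝒳 → ℝ) (x : ℕ → 𝒳) (t : ℕ) :
    empLoss f x t (inducedRule f) = 0 := by
  simp [empLoss]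

/-- If the model selection has not reached `k⋆`, the structure below `k⋆` holds a rule which is
consistent with the sample. -/
theorem exists_empLoss_eq_zero_of_kHat_ne {f : 𝒳 → ℝ} {R : ℕ → Set (RankingRule 𝒳)}
    (hR : ∀ k, 1 ≤ k → R k ⊆ R (k + 1)) {kStar : ℕ}
    (hk : IsLeast {k | 1 ≤ k ∧ inducedRule f ∈ R k} kStar) {x : ℕ → 𝒳} {t : ℕ}
    (h : kHat f R x t ≠ kStar) : ∃ r ∈ R (kStar - 1), empLoss f x t r = 0 := by
  have hmem : kStar ∈ {k | 1 ≤ k ∧ ∃ r ∈ R k, empLoss f x t r = 0} :=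
    ⟨hk.1.1, inducedRule f, hk.1.2, empLoss_inducedRule f x t⟩
  have hlt : kHat f R x t < kStar := lt_of_le_of_ne (Nat.sInf_le hmem) h
  obtain ⟨h1, r, hr, hr0⟩ := Nat.sInf_mem ⟨_, hmem⟩
  refine ⟨r, ?_, hr0⟩
  have hmono : ∀ k l, 1 ≤ k → k ≤ l → R k ⊆ R l := by
    intro k l hk hkl
    induction l, hkl using Nat.le_induction with
    | base => exact subset_rfl
    | succ l hkl ih => exact ih.trans (hR l (hk.trans hkl))
  exact hmono _ _ h1 (Nat.le_sub_one_of_lt hlt) hr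

/-! ### The stopping time -/

/-- The deviation bound and the choice of the number `n` of exploration points balance: the
constant `5 = 4 + 1` comes from `(2 √K + √l)² ≤ 5 (K + l)`. -/
theorem deviation_arith {K l L n : ℝ} (hK : 0 < K) (hl : 0 < l) (hL : 0 < L)
    (hn : 5 * ((K + l) / L ^ 2) ≤ n) :
    2 * √(K / n) ≤ L ∧ l ≤ n * (L - 2 * √(K / n)) ^ 2 := by
  have hn0 : 0 < n := lt_of_lt_of_le (by positivity) hn
  have ha : 0 < √n := Real.sqrt_pos.2 hn0
  have hnL : 5 * (K + l) ≤ (√n * L) ^ 2 := by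
    rw [← mul_div_assoc, div_le_iff₀ (by positivity)] at hn
    rwa [mul_pow, Real.sq_sqrt hn0.le]
  have h1 : 2 * √K + √l ≤ √n * L := by
    refine abs_le_of_sq_le_sq' (le_trans ?_ hnL) (by positivity) |>.2
    nlinarith [Real.sq_sqrt hK.le, Real.sq_sqrt hl.le, sq_nonneg (√K - 2 * √l)]
  have h2 : √n * (L - 2 * √(K / n)) = √n * L - 2 * √K := by
    rw [Real.sqrt_div hK.le]
    field_simp
  have h3 : √l ≤ √n * (L - 2 * √(K / n)) := by linarith
  refine ⟨?_, ?_⟩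
  · have := pos_of_mul_pos_right ((Real.sqrt_pos.2 hl).trans_le h3) ha.le
    linarith
  · calc l = √l ^ 2 := (Real.sq_sqrt hl.le).symm
      _ ≤ (√n * (L - 2 * √(K / n))) ^ 2 := by gcongr
      _ = _ := by rw [mul_pow, Real.sq_sqrt hn0.le]

/-- With `t` evaluations, about `10 q` exploration points are expected, and it is unlikely that at
most `n - 2 < 5 q` of them come from the coins. -/
theorem coin_arith {p l q : ℝ} (hp : p ∈ Set.Ioo (0 : ℝ) 1) (hl : 0 < l) (hq : 2 + l ≤ q)
    {t a : ℕ} (ht : 10 / p * q < t + 1) (ha : (a : ℝ) ≤ 5 * q) :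
    (2 : ℝ) ^ a * Real.exp (-(p * (t - 1) / 2)) ≤ Real.exp (-l) := by
  have h2 : (2 : ℝ) ^ a = Real.exp (Real.log 2 * a) := by
    rw [Real.exp_mul, Real.exp_log two_pos, Real.rpow_natCast]
  rw [h2, ← Real.exp_add, Real.exp_le_exp]
  have hpt : 10 * q < p * (t + 1) := by
    rw [div_mul_eq_mul_div, div_lt_iff₀ hp.1] at ht
    linarith
  have hlog : Real.log 2 * a ≤ 0.6931471808 * (5 * q) := by
    have := Real.log_two_lt_d9.le
    gcongr
  have := hp.2
  linarith

/-- If the rules in `M` have true loss at least `L`, they are unlikely to be consistent with `r_f`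
on a sample of `n` i.i.d. uniform points. -/
theorem measure_exists_consistent_le [IsProbabilityMeasure (unif (Set.univ : Set 𝒳))]
    {f : 𝒳 → ℝ} (hf : inducedRule f ∈ continuousRules 𝒳) {M : Set (RankingRule 𝒳)} [Nonempty M]
    (hM : M ⊆ continuousRules 𝒳) {K l L : ℝ} (hK : 0 < K) (hl : 0 < l) (hL : 0 < L)
    (hML : ∀ r ∈ M, L ≤ trueLoss f r) {n : ℕ} (hn : Even n) (hn5 : 5 * ((K + l) / L ^ 2) ≤ n)
    (hint : Integrable (rademacherAvg f M n) (rademacherLaw 𝒳 n))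
    (hRad : ∫ z, rademacherAvg f M n z ∂(rademacherLaw 𝒳 n) ≤ √(K / n)) :
    (Measure.pi fun _ : Fin n => unif (Set.univ : Set 𝒳))
        {z | ∃ r ∈ M, ∀ i, rankLoss f r (pairs n z i) = 0} ≤
      ENNReal.ofReal (Real.exp (-l)) := by
  have hn0 : (0 : ℝ) < n := lt_of_lt_of_le (by positivity) hn5
  have hhalf : 2 * ((n / 2 : ℕ) : ℝ) = n := by exact_mod_cast Nat.two_mul_div_two_of_even hn
  obtain ⟨hle, hexp⟩ := deviation_arith hK hl hL hn5
  have hdev := measure_exists_forall_eq_zero_le (ℓ := fun r : M => rankLoss f r.1)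
    (fun r => rankLoss_mem_Icc f r.1) ((unif (Set.univ : Set 𝒳)).prod (unif Set.univ))
    (fun r => measurable_rankLoss hf (hM r.2)) (m := n / 2)
    (by have : 0 < n := by exact_mod_cast hn0
        obtain ⟨m, rfl⟩ := hn
        omega)
    (aestronglyMeasurable_signedSup_of_rademacherAvg hn hint) (L := L) (ρ := √(K / n))
    (fun r => by
      rw [integral_rankLoss (measurable_rankLoss hf (hM r.2))]
      exact hML _ r.2)
    ((integral_rademacherAvg hn hint).symm.trans_le hRad) hle
  have hmp := measurePreserving_pairs hn (unif (Set.univ : Set 𝒳))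
  calc (Measure.pi fun _ : Fin n => unif (Set.univ : Set 𝒳))
        {z | ∃ r ∈ M, ∀ i, rankLoss f r (pairs n z i) = 0}
      ≤ (Measure.pi fun _ : Fin (n / 2) => (unif (Set.univ : Set 𝒳)).prod (unif Set.univ))
        {y | ∃ r : M, ∀ j, rankLoss f r.1 (y j) = 0} := by
        rw [← hmp.map_eq]
        refine (measure_mono ?_).trans (Measure.le_map_apply hmp.aemeasurable _)
        rintro z ⟨r, hr, hz⟩
        exact ⟨⟨r, hr⟩, hz⟩
    _ ≤ _ := hdev
    _ ≤ _ := by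
        refine ENNReal.ofReal_le_ofReal (Real.exp_le_exp.2 (neg_le_neg ?_))
        rwa [hhalf]

/-- The Rademacher average of two points shows that `K` cannot be small. -/
theorem two_mul_sq_le_of_rademacherAvg [IsProbabilityMeasure (unif (Set.univ : Set 𝒳))]
    {f : 𝒳 → ℝ} (hf : inducedRule f ∈ continuousRules 𝒳) {M : Set (RankingRule 𝒳)}
    (hM : M ⊆ continuousRules 𝒳) {K L : ℝ} (hK : 0 < K) (hL : 0 < L) {r : RankingRule 𝒳}
    (hr : r ∈ M) (hLr : L ≤ trueLoss f r)
    (hint : Integrable (rademacherAvg f M 2) (rademacherLaw 𝒳 2))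
    (hRad : ∫ z, rademacherAvg f M 2 z ∂(rademacherLaw 𝒳 2) ≤ √(K / 2)) :
    2 * L ^ 2 ≤ K := by
  have h := le_integral_signedSup_of_eq_one (ℓ := fun r : M => rankLoss f r.1)
    (fun r => rankLoss_mem_Icc f r.1) ((unif (Set.univ : Set 𝒳)).prod (unif Set.univ))
    (fun r => measurable_rankLoss hf (hM r.2)) (m := 2 / 2) rfl
    (aestronglyMeasurable_signedSup_of_rademacherAvg even_two hint) ⟨r, hr⟩
  rw [integral_rankLoss (measurable_rankLoss hf (hM hr)), ← integral_rademacherAvg even_two hint]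
    at h
  have h1 : L ≤ √(K / 2) := hLr.trans (h.trans hRad)
  have h2 : L ^ 2 ≤ K / 2 := (Real.le_sqrt hL.le (by positivity)).1 h1
  linarith

end AdaRank

theorem mainTheorem4 {d : ℕ} (𝒳 : Set (EuclideanSpace ℝ (Fin d)))
    (h𝒳_compact : IsCompact 𝒳) (h𝒳_convex : Convex ℝ 𝒳) (h𝒳_int : (interior 𝒳).Nonempty)
    (f : 𝒳 → ℝ) (p : ℝ) (hp : p ∈ Set.Ioo (0 : ℝ) 1)
    -- a nested sequence `R 1 ⊆ R 2 ⊆ ⋯ ⊆ R_∞` of ranking structures (`R 0` plays no role)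
    (R : ℕ → Set (RankingRule 𝒳))
    (hR_nested : ∀ k, 1 ≤ k → R k ⊆ R (k + 1))
    (hR_cont : ∀ k, 1 ≤ k → R k ⊆ continuousRules 𝒳)
    -- a run of AdaRankOpt
    {Ω : Type*} [MeasurableSpace Ω] (P : Measure Ω) [IsProbabilityMeasure P]
    (X : ℕ → Ω → 𝒳) (B : ℕ → Ω → Bool) (best : ℕ → Ω → ℕ)
    (hrun : IsAdaRankOpt P f p R X B best)
    -- the index `k⋆` is finite and greater than one
    (kStar : ℕ) (hkStar : IsLeast {k | 1 ≤ k ∧ inducedRule f ∈ R k} kStar)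
    (hkStar_gt : 1 < kStar)
    (hL : 0 < ⨅ r : R (kStar - 1), trueLoss f r.1)
    (K : ℝ) (hK : 0 < K)
    (hRad : ∀ n : ℕ, 1 ≤ n →
      Integrable (rademacherAvg f (R (kStar - 1)) n) (rademacherLaw 𝒳 n) ∧
      ∫ z, rademacherAvg f (R (kStar - 1)) n z ∂(rademacherLaw 𝒳 n) ≤ √(K / n))
    (δ : ℝ) (hδ : δ ∈ Set.Ioo (0 : ℝ) 1) :
    -- with probability at least `1 - δ` (there is an event of at least this probability on which)
    ∃ A : Set Ω, MeasurableSet A ∧ ENNReal.ofReal (1 - δ) ≤ P A ∧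
      ∀ ω ∈ A, (stoppingTime f R X kStar ω : ℝ≥0∞) ≤
        ENNReal.ofReal (10 / p *
          ((K + Real.log (2 / δ)) / (⨅ r : R (kStar - 1), trueLoss f r.1) ^ 2)) := by
  have hμ : IsProbabilityMeasure (unif (Set.univ : Set 𝒳)) :=
    isProbabilityMeasure_unif_univ h𝒳_compact h𝒳_int
  set M := R (kStar - 1) with hM_def
  set L : ℝ := ⨅ r : M, trueLoss f r.1 with hL_def
  set l : ℝ := Real.log (2 / δ) with hl_def
  have hl : 0 < l := Real.log_pos (by rw [lt_div_iff₀ hδ.1]; linarith [hδ.2])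
  have hexpl : Real.exp (-l) = δ / 2 := by
    rw [Real.exp_neg, Real.exp_log (div_pos two_pos hδ.1), inv_div]
  have hf : inducedRule f ∈ continuousRules 𝒳 := hR_cont kStar hkStar.1.1 hkStar.1.2
  have hMc : M ⊆ continuousRules 𝒳 := hR_cont _ (by omega)
  have hne : Nonempty M := by
    by_contra hcon
    rw [not_nonempty_iff] at hcon
    rw [hL_def, Real.iInf_of_isEmpty] at hL
    exact lt_irrefl _ hL
  have hML : ∀ r ∈ M, L ≤ trueLoss f r := fun r hr =>
    ciInf_le (f := fun r : M => trueLoss f r.1)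
      ⟨0, by rintro _ ⟨r, rfl⟩; exact measureReal_nonneg⟩ ⟨r, hr⟩
  obtain ⟨⟨r₀, hr₀⟩⟩ := hne
  have hne : Nonempty M := ⟨⟨r₀, hr₀⟩⟩
  have hL1 : L ≤ 1 := (hML r₀ hr₀).trans measureReal_le_one
  set q : ℝ := (K + l) / L ^ 2 with hq_def
  have hq : 2 + l ≤ q := by
    have h2K := two_mul_sq_le_of_rademacherAvg hf hMc hK hL hr₀ (hML r₀ hr₀)
      (hRad 2 one_le_two).1 (hRad 2 one_le_two).2
    rw [hq_def, le_div_iff₀ (by positivity), add_mul]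
    have : l * L ^ 2 ≤ l := mul_le_of_le_one_right hl.le (pow_le_one₀ hL.le hL1)
    linarith
  -- among the first `t` evaluations, at least `n` are exploration points with high probability
  set t : ℕ := ⌊10 / p * q⌋₊ with ht_def
  set n : ℕ := 2 * ⌈5 / 2 * q⌉₊ with hn_def
  have hT0 : 0 ≤ 10 / p * q := by
    have := hp.1
    have : 0 ≤ q := by linarith
    positivity
  have ht1 : 1 ≤ t := by
    rw [ht_def, Nat.one_le_floor_iff, div_mul_eq_mul_div, le_div_iff₀ hp.1]
    linarith [hp.2]
  have hn_ge : 5 * q ≤ n := by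
    have := Nat.le_ceil (5 / 2 * q)
    rw [hn_def]
    push_cast
    linarith
  have hn_le : (n : ℝ) ≤ 5 * q + 2 := by
    have := Nat.ceil_lt_add_one (show 0 ≤ 5 / 2 * q by linarith)
    rw [hn_def]
    push_cast
    linarith
  have hn2 : 2 ≤ n := by
    have : (2 : ℝ) ≤ n := by linarith
    exact_mod_cast this
  set Fail : Set Ω := {ω | kHat f R (fun i => X i ω) t ≠ kStar} with hFail
  have hsub : Fail ⊆ {ω | coinCount B t ω ≤ n - 2} ∪
      {ω | n ≤ coinCount B t ω + 1 ∧ ∀ e : Fin n → ℕ, StrictMono e →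
        (∀ j, e j ∈ Finset.Icc 1 t) → (fun j => X (e j) ω) ∈
          {z | ∃ r ∈ M, ∀ i, rankLoss f r (pairs n z i) = 0}} := by
    intro ω hω
    rcases le_or_gt (coinCount B t ω) (n - 2) with hc | hc
    · exact Or.inl hc
    · refine Or.inr ⟨by omega, fun e he het => ?_⟩
      obtain ⟨r, hr, hr0⟩ := exists_empLoss_eq_zero_of_kHat_ne hR_nested hkStar hω
      refine ⟨r, hr, fun i => ?_⟩
      have := eq_inducedRule_of_empLoss_eq_zero hr0 (Finset.mem_Icc.1 (het _)).1
        (he (show (⟨i, by omega⟩ : Fin n) < ⟨n / 2 + i, by omega⟩ from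
          Fin.mk_lt_mk.2 (by omega))) (Finset.mem_Icc.1 (het _)).2
      simp [rankLoss, pairs, this]
  have hPfail : P Fail ≤ ENNReal.ofReal δ := by
    calc P Fail ≤ ENNReal.ofReal (δ / 2) + ENNReal.ofReal (δ / 2) := by
          refine (measure_mono hsub).trans ((measure_union_le _ _).trans (add_le_add ?_ ?_))
          · refine (hrun.measure_coinCount_le hp ht1 (n - 2)).trans
              (ENNReal.ofReal_le_ofReal ?_)
            rw [← hexpl]
            refine coin_arith hp hl hq (Nat.lt_floor_add_one _) ?_
            rw [Nat.cast_sub hn2]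
            push_cast
            linarith
          · rw [← hexpl]
            refine (hrun.measure_forall_explore_mem_le ht1 _).trans ?_
            exact measure_exists_consistent_le hf hMc hK hl hL hML (even_two_mul _) hn_ge
              (hRad n (by omega)).1 (hRad n (by omega)).2
      _ = ENNReal.ofReal δ := by
          rw [← ENNReal.ofReal_add (by linarith [hδ.1]) (by linarith [hδ.1]), add_halves]
  refine ⟨(toMeasurable P Fail)ᶜ, (measurableSet_toMeasurable _ _).compl, ?_, fun ω hω => ?_⟩
  · rw [prob_compl_eq_one_sub (measurableSet_toMeasurable _ _), measure_toMeasurable,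
      ENNReal.ofReal_sub _ hδ.1.le, ENNReal.ofReal_one]
    exact tsub_le_tsub_left hPfail 1
  · have hk : kHat f R (fun i => X i ω) t = kStar := by
      by_contra hcon
      exact hω (subset_toMeasurable P Fail hcon)
    have hτ : stoppingTime f R X kStar ω ≤ (t : ℕ∞) := iInf₂_le t ⟨ht1, hk⟩
    calc (stoppingTime f R X kStar ω : ℝ≥0∞) ≤ ((t : ℕ∞) : ℝ≥0∞) := by exact_mod_cast hτ
      _ = ENNReal.ofReal (t : ℝ) := by simp
      _ ≤ _ := ENNReal.ofReal_le_ofReal (Nat.floor_le hT0)
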